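/- All logarithms are to base two, $x^+=\max\{x,0\}$, and $\{0,1\}^*$ is the set of finite binary strings. Source model. Let $P$ be a distribution on $\mathbb{N}$ with mean $\mathbb{E}(L)$ such that $L\sim P$ satisfies $\mathbb{E}(L)/2\le L\le 2\mathbb{E}(L)$ almost surely, and let $A$ be an integer with $2\le A\le 2^{\mathbb{E}(L)/2-1}$. Draw $L_1,\dots,L_A$ i.i.d. from $P$ and then, for $a=1,\dots,A$, draw the source symbol $X_a$ uniformly from $\{0,1\}^{L_a}\setminus\{X_1,\dots,X_{a-1}\}$. Draw source blocks $Y_1,\dots,Y_B$ independently and uniformly from the alphabet $\{X_1,\dots,X_A\}$. The source sequence is the concatenation $S=Y_1Y_2\cdots Y_B$, without delimiters. Let $R^\star$ be the smallest expected codeword length of a prefix-free binary code for the random variable $S$. Variable-length deduplication with anchor length $M\ge 1$. Fix a prefix-free binary code for the positive integers whose codeword for $n$ has at most $2\log n+3$ bits (for example the Elias gamma code). Encode first the length of $S$ with this code. Parse $S=Z_1Z_2\cdots Z_C$ into chunks such that each chunk, except perhaps the last one, contains the all-zero string $0^M$ exactly once, namely at its end, and the last chunk contains it at most there. Process the chunks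 in order, with an initially empty dictionary: a chunk that is not in the dictionary is encoded as the bit $1$ followed by the chunk itself and is appended to the dictionary; a chunk that is in the dictionary is encoded as the bit $0$ followed by its position, written with $\lceil\log d\rceil$ bits, where $d$ is the current size of the dictionary. Let $R_{\mathsf{VL}}(M)$ be the expected total number of bits. Theorem. There is a constant $B_0$, independent of $A$, of $P$ and of the integer code, such that for all $B\ge B_0$ the following holds: $0<R^\star<\infty$, $R_{\mathsf{VL}}(M)/R^\star\ge 1$ for every $M\ge 1$, and both for $R_{\mathsf{VL}}=R_{\mathsf{VL}}(M)$ with $M=\lceil\tfrac12\log\mathbb{E}(L)\rceil\ge 1$ and for the optimized rate $R_{\mathsf{VL}}=\inf_{M\ge 1}R_{\mathsf{VL}}(M)$, $$1\le\frac{R_{\mathsf{VL}}}{R^\star}\le 1+\frac{4B\bigl(1+\sqrt{\mathbb{E}(L)}\bigr)\log\bigl(B\,\mathbb{E}(L)\bigr)}{\bigl(\min\{A,B\}(\mathbb{E}(L)-1)+(B-A)^+\log(A/2)-2B\log(2\mathbb{E}(L))\bigr)^+},$$ where the right-hand side is $+\infty$ if its denominator is $0$. -/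

import Mathlib

open scoped ENNReal

namespace Dedup

/-! Binary strings are lists of Booleans: `false` is the bit 0 and `true` is the bit 1. -/

/-! ### The random source -/

/-- The set `{0,1}^n` of binary strings of length `n`. -/
def strings (n : ℕ) : Finset (List Bool) :=
  (Finset.univ : Finset (Fin n → Bool)).image List.ofFn

/-- The uniform distribution on a finite set of binary strings. On the empty set, where there is
no such distribution, the value is the point mass at the empty string. -/
noncomputable def unif (s : Finset (List Bool)) : PMF (List Bool) :=
  open Classical in
  if h : s.Nonempty then PMF.uniformOfFinset s h else PMF.pure []

/-- The law of `n` independent draws from `p`. -/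
noncomputable def iid {α : Type*} (p : PMF α) : ℕ → PMF (List α)
  | 0 => PMF.pure []
  | n + 1 => p.bind fun a => (iid p n).map fun l => a :: l

/-- Given the set `X` of the source symbols drawn so far and the lengths of the remaining ones,
draw each remaining symbol uniformly among the strings of its length that differ from all symbols
drawn before it. The result is the random set of all source symbols. -/
noncomputable def symbolsLaw : Finset (List Bool) → List ℕ → PMF (Finset (List Bool))
  | X, [] => PMF.pure X
  | X, n :: ns => (unif (strings n \ X)).bind fun x => symbolsLaw (insert x X) ns

/-- The law of the source alphabet: `A` independent lengths with distribution `P`, then the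
source symbols of these lengths, drawn without replacement. -/
noncomputable def alphabetLaw (P : PMF ℕ) (A : ℕ) : PMF (Finset (List Bool)) :=
  (iid P A).bind fun lengths => symbolsLaw ∅ lengths

/-- The law of the source sequence: draw the alphabet, then `B` source blocks independently and
uniformly from the alphabet, and concatenate the blocks. -/
noncomputable def sourceLaw (P : PMF ℕ) (A B : ℕ) : PMF (List Bool) :=
  (alphabetLaw P A).bind fun X => (iid (unif X) B).map List.flatten

/-- The mean of a distribution on `ℕ`. -/
noncomputable def mean (P : PMF ℕ) : ℝ := ∑' n : ℕ, (P n).toReal * (n : ℝ)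

/-! ### Source codes and the optimal rate -/

/-- On the set `s`, no codeword of `φ` is a prefix of the codeword of a different element. -/
def PrefixFreeOn {α : Type*} (s : Set α) (φ : α → List Bool) : Prop :=
  ∀ x ∈ s, ∀ y ∈ s, φ x <+: φ y → x = y

/-- The expected codeword length of `φ` on a source with distribution `p`. -/
noncomputable def rate {α : Type*} (p : PMF α) (φ : α → List Bool) : ℝ≥0∞ :=
  ∑' x, p x * ((φ x).length : ℝ≥0∞)

/-- The expected length of the optimal prefix-free code for a source with distribution `p`. -/
noncomputable def optimalRate {α : Type*} (p : PMF α) : ℝ≥0∞ :=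
  ⨅ (φ : α → List Bool) (_ : PrefixFreeOn p.support φ), rate p φ

/-- A prefix-free code for the positive integers that spends at most `2 log₂ n + 3` bits
on `n`. -/
def IsUniversalIntegerCode (γ : ℕ → List Bool) : Prop :=
  PrefixFreeOn {n : ℕ | 1 ≤ n} γ ∧
    ∀ n : ℕ, 1 ≤ n → ((γ n).length : ℝ) ≤ 2 * Real.logb 2 n + 3

/-! ### Variable-length deduplication -/

/-- Chunking with anchor `0^M`, where `cur` is the part of the current chunk read so far. -/
def chunksAux (M : ℕ) : List Bool → List Bool → List (List Bool)
  | cur, [] => if cur = [] then [] else [cur]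
  | cur, b :: s =>
    if List.replicate M false <:+ cur ++ [b] then (cur ++ [b]) :: chunksAux M [] s
    else chunksAux M (cur ++ [b]) s

/-- The parsing of a string into chunks, each of which, except perhaps the last one, contains
the anchor `0^M` exactly once, namely at its end. -/
def chunks (M : ℕ) (s : List Bool) : List (List Bool) := chunksAux M [] s

/-- The binary representation of `n` with `w` bits, most significant bit first. -/
def toBits (w n : ℕ) : List Bool := List.ofFn fun i : Fin w => n.testBit (w - 1 - i)

/-- Encoding of a sequence of chunks with a growing dictionary. A new chunk `z` is encoded as the
bit 1 followed by `z`, and is appended to the dictionary. A chunk from the dictionary is encoded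
as the bit 0 followed by its position in the dictionary, for which `⌈log₂ (size)⌉` bits are
used. -/
def encodeChunks : List (List Bool) → List (List Bool) → List Bool
  | _, [] => []
  | dict, z :: zs =>
    if z ∈ dict then
      false :: (toBits (Nat.clog 2 dict.length) (dict.idxOf z) ++ encodeChunks dict zs)
    else true :: (z ++ encodeChunks (dict ++ [z]) zs)

/-- Variable-length deduplication with anchor `0^M`: the length of the source sequence, encoded
with the integer code `γ`, followed by the encoding of the chunks. -/
def encodeVL (γ : ℕ → List Bool) (M : ℕ) (s : List Bool) : List Bool :=
  γ s.length ++ encodeChunks [] (chunks M s)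

/-- The expected number of bits used by variable-length deduplication with anchor length `M`. -/
noncomputable def rateVL (γ : ℕ → List Bool) (P : PMF ℕ) (A B M : ℕ) : ℝ≥0∞ :=
  rate (sourceLaw P A B) (encodeVL γ M)

/-- The expected number of bits used by variable-length deduplication with the best anchor
length. -/
noncomputable def optimizedRateVL (γ : ℕ → List Bool) (P : PMF ℕ) (A B : ℕ) : ℝ≥0∞ :=
  ⨅ (M : ℕ) (_ : 1 ≤ M), rateVL γ P A B M

/-- The anchor length `⌈(1/2) log₂ E(L)⌉`. -/
noncomputable def anchorLength (P : PMF ℕ) : ℕ := ⌈Real.logb 2 (mean P) / 2⌉₊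

end Dedup

/-! The proof bounds the two rates separately and compares them. Write `e` for the expected number
of distinct source symbols that occur among the blocks, that is `A * hitProb A B`; it lies between
`min A B / 2` and `B`.

Upper bound (`rateVL_le`). Whatever precedes a block, its chunking is the same after the first chunk
end that follows its first 1. The chunks from there on recur with every repetition of the block, so
they enter the dictionary once per distinct block and cost `e * E(L)` bits on average. Outside them
lie the bits before synchronization and the unfinished chunk at the end of the block. Waiting-time
recursions for a run of `M` zeros bound these by `2^(M+2)` bits per block. The number of chunks is
about `B + B * E(L) / 2^M`, each costing at most an index of about `log(B * E(L))` bits on top. With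
`2^M` between `√E(L)` and `2√E(L)`, the total exceeds `e * (E(L) - 1)` by at most a third of the
numerator (`redundancy_le`).

Lower bounds. If all probabilities are at most `2^(-h)`, the rate is at least `h`
(`le_rate_of_forall_le`, from Kraft's inequality), and this may be applied conditionally on side
information (`expect_le_optimalRate_bind`). Given the lengths and the block indices, the sequence
reveals every symbol that occurs, each of conditional probability at most `2^(1-L)`, whence `R* ≥ e
* (E(L) - 1)` (`mul_expect_le_optimalRate`). Given the alphabet, a string has at most `(2E(L))^B`
parsings, whence `R* ≥ B * (log A - log(2E(L)))` (`le_optimalRate_of_alphabet`). Twice the first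
bound plus the second shows that the denominator is at most `3R*` (`denominator_le`), so a
redundancy of a third of the numerator suffices. The ratio is at least 1 because deduplication is
itself a prefix-free code (`prefixFreeOn_encodeVL`). -/

namespace Dedup

/-! ### Expectations with respect to a discrete distribution -/

/-- The expectation of a nonnegative function. -/
noncomputable def expect {α : Type*} (p : PMF α) (f : α → ℝ≥0∞) : ℝ≥0∞ := ∑' x, p x * f x

section expect

variable {α β : Type*}

lemma expect_pure (a : α) (f : α → ℝ≥0∞) : expect (PMF.pure a) f = f a := by
  classical
  unfold expect
  rw [tsum_eq_single a]
  · simp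
  · intro b hb
    simp [PMF.pure_apply, hb]

lemma expect_bind (p : PMF α) (k : α → PMF β) (f : β → ℝ≥0∞) :
    expect (p.bind k) f = expect p fun a => expect (k a) f := by
  unfold expect
  simp only [PMF.bind_apply, ← ENNReal.tsum_mul_right, ← ENNReal.tsum_mul_left]
  rw [ENNReal.tsum_comm]
  simp only [mul_assoc]

lemma expect_map (p : PMF α) (g : α → β) (f : β → ℝ≥0∞) :
    expect (p.map g) f = expect p fun a => f (g a) := by
  rw [← PMF.bind_pure_comp, expect_bind]
  simp [expect_pure]

lemma expect_mono_support {p : PMF α} {f g : α → ℝ≥0∞} (h : ∀ x ∈ p.support, f x ≤ g x) :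
    expect p f ≤ expect p g := by
  refine ENNReal.tsum_le_tsum fun x => ?_
  by_cases hx : x ∈ p.support
  · gcongr
    exact h x hx
  · rw [(p.apply_eq_zero_iff x).2 hx]
    simp

lemma expect_congr_support {p : PMF α} {f g : α → ℝ≥0∞} (h : ∀ x ∈ p.support, f x = g x) :
    expect p f = expect p g :=
  le_antisymm (expect_mono_support fun x hx => (h x hx).le)
    (expect_mono_support fun x hx => (h x hx).ge)

lemma expect_const (p : PMF α) (c : ℝ≥0∞) : expect p (fun _ => c) = c := by
  simp [expect, ENNReal.tsum_mul_right, p.tsum_coe]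

lemma expect_add (p : PMF α) (f g : α → ℝ≥0∞) :
    expect p (fun x => f x + g x) = expect p f + expect p g := by
  simp [expect, mul_add, ENNReal.tsum_add]

lemma expect_const_mul (p : PMF α) (c : ℝ≥0∞) (f : α → ℝ≥0∞) :
    expect p (fun x => c * f x) = c * expect p f := by
  simp only [expect, ← ENNReal.tsum_mul_left]
  congr 1
  ext x
  ring

lemma expect_mul_const (p : PMF α) (c : ℝ≥0∞) (f : α → ℝ≥0∞) :
    expect p (fun x => f x * c) = expect p f * c := by
  simp only [mul_comm _ c, expect_const_mul]

lemma expect_sum {ι : Type*} (p : PMF α) (s : Finset ι) (f : ι → α → ℝ≥0∞) :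
    expect p (fun x => ∑ i ∈ s, f i x) = ∑ i ∈ s, expect p (f i) := by
  classical
  induction s using Finset.induction_on with
  | empty => simp [expect]
  | insert a s ha ih => simp only [Finset.sum_insert ha, expect_add, ih]

lemma expect_comm (p : PMF α) (q : PMF β) (f : α → β → ℝ≥0∞) :
    expect p (fun a => expect q (f a)) = expect q fun b => expect p fun a => f a b := by
  unfold expect
  simp only [← ENNReal.tsum_mul_left]
  rw [ENNReal.tsum_comm]
  simp only [mul_left_comm]

lemma expect_uniformOfFinset (s : Finset α) (hs : s.Nonempty) (f : α → ℝ≥0∞) :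
    expect (PMF.uniformOfFinset s hs) f = (s.card : ℝ≥0∞)⁻¹ * ∑ x ∈ s, f x := by
  unfold expect
  rw [tsum_eq_sum (s := s)]
  · rw [Finset.mul_sum]
    refine Finset.sum_congr rfl fun x hx => ?_
    rw [PMF.uniformOfFinset_apply_of_mem _ hx]
  · intro x hx
    rw [PMF.uniformOfFinset_apply_of_notMem _ hx, zero_mul]

lemma expect_indicator [DecidableEq α] (p : PMF α) (a : α) :
    expect p (fun x => if x = a then 1 else 0) = p a := by
  unfold expect
  rw [tsum_eq_single a]
  · simp
  · intro b hb
    simp [hb]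

lemma apply_map_eq_expect [DecidableEq β] (p : PMF α) (g : α → β) (b : β) :
    p.map g b = expect p fun a => if g a = b then 1 else 0 := by
  rw [← expect_indicator, expect_map]

lemma rate_eq_expect (p : PMF α) (φ : α → List Bool) :
    rate p φ = expect p fun x => ((φ x).length : ℝ≥0∞) := rfl

end expect

/-! ### Lower bounds on the rate of prefix-free codes -/

lemma uniquelyDecodable_of_prefixFree {S : Set (List Bool)} (h0 : [] ∉ S)
    (h : ∀ u ∈ S, ∀ v ∈ S, u <+: v → u = v) : InformationTheory.UniquelyDecodable S := by
  intro L₁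
  induction L₁ with
  | nil =>
    intro L₂ _ h₂ he
    cases L₂ with
    | nil => rfl
    | cons w t =>
      simp only [List.flatten_nil, List.flatten_cons] at he
      have := List.append_eq_nil_iff.1 he.symm
      exact absurd (this.1 ▸ h₂ w (by simp)) h0
  | cons u t ih =>
    intro L₂ h₁ h₂ he
    cases L₂ with
    | nil =>
      simp only [List.flatten_nil, List.flatten_cons] at he
      have := List.append_eq_nil_iff.1 he
      exact absurd (this.1 ▸ h₁ u (by simp)) h0
    | cons v t' =>
      simp only [List.flatten_cons] at he
      have hu := h₁ u (by simp)
      have hv := h₂ v (by simp)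
      have huv : u = v := by
        rcases List.append_eq_append_iff.1 he with ⟨w, hw, -⟩ | ⟨w, hw, -⟩
        · exact h u hu v hv ⟨w, hw.symm⟩
        · exact (h v hv u hu ⟨w, hw.symm⟩).symm
      subst huv
      rw [ih t' (fun w hw => h₁ w (by simp [hw])) (fun w hw => h₂ w (by simp [hw]))
        (List.append_cancel_left he)]

lemma kraft_of_prefixFree (S : Finset (List Bool))
    (h : ∀ u ∈ S, ∀ v ∈ S, u <+: v → u = v) : ∑ w ∈ S, (1 / 2 : ℝ) ^ w.length ≤ 1 := by
  -- A prefix-free set containing the empty word is a singleton; it has to be treated apart because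
  -- it is not uniquely decodable.
  by_cases h0 : [] ∈ S
  · have hS : S = {[]} := by
      ext w
      constructor
      · intro hw
        rw [h [] h0 w hw List.nil_prefix]
        simp
      · intro hw
        rw [Finset.mem_singleton.1 hw]
        exact h0
    simp [hS]
  · have := InformationTheory.kraft_mcmillan_inequality (S := S)
      (uniquelyDecodable_of_prefixFree (by simpa using h0) (by simpa using h))
    simpa using this

lemma kraft_tsum {α : Type*} {s : Set α} {φ : α → List Bool} (h : PrefixFreeOn s φ) :
    ∑' x : s, ENNReal.ofReal ((1 / 2 : ℝ) ^ (φ x).length) ≤ 1 := by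
  classical
  rw [ENNReal.tsum_eq_iSup_sum]
  refine iSup_le fun t => ?_
  rw [← ENNReal.ofReal_sum_of_nonneg (fun _ _ => by positivity), ← ENNReal.ofReal_one]
  refine ENNReal.ofReal_le_ofReal ?_
  have hinj : Set.InjOn (fun x : s => φ x) t := by
    intro x _ y _ hxy
    exact Subtype.ext (h x x.2 y y.2 (List.prefix_iff_eq_append.2 (by simp [show φ x = φ y from hxy])))
  rw [← Finset.sum_image (f := fun w : List Bool => (1 / 2 : ℝ) ^ w.length) hinj]
  refine kraft_of_prefixFree _ fun u hu v hv huv => ?_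
  obtain ⟨x, -, rfl⟩ := Finset.mem_image.1 hu
  obtain ⟨y, -, rfl⟩ := Finset.mem_image.1 hv
  rw [h x x.2 y y.2 huv]

/-- The tangent inequality `1 + x ≤ exp x` at `x = (h - n) log 2`. Averaged over the source, with
`n` the codeword length, it turns Kraft's inequality into a bound on the rate without any mention of
entropy. -/
lemma one_add_mul_log_two_le (h : ℝ) (n : ℕ) :
    1 + h * Real.log 2 ≤ (2 : ℝ) ^ h * (1 / 2 : ℝ) ^ n + Real.log 2 * n := by
  have h1 : (2 : ℝ) ^ h * (1 / 2 : ℝ) ^ n = Real.exp (Real.log 2 * (h - n)) := by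
    rw [← Real.rpow_def_of_pos (by norm_num), Real.rpow_sub (by norm_num), Real.rpow_natCast]
    simp [div_eq_mul_inv]
  rw [h1]
  have := Real.add_one_le_exp (Real.log 2 * (h - n))
  nlinarith

/-- A source with all probabilities at most `2^{-h}` has no prefix-free code of rate less
than `h`. -/
lemma le_rate_of_forall_le {α : Type*} {p : PMF α} {φ : α → List Bool} {s : Set α}
    (hs : p.support ⊆ s) (hφ : PrefixFreeOn s φ) {h : ℝ}
    (hp : ∀ x, p x ≤ ENNReal.ofReal ((2 : ℝ) ^ (-h))) : ENNReal.ofReal h ≤ rate p φ := by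
  rcases le_total h 0 with hh | hh
  · rw [ENNReal.ofReal_of_nonpos hh]
    exact zero_le
  have hl : 0 < Real.log 2 := Real.log_pos (by norm_num)
  have key : 1 + ENNReal.ofReal (Real.log 2) * ENNReal.ofReal h
      ≤ 1 + ENNReal.ofReal (Real.log 2) * rate p φ := by
    calc 1 + ENNReal.ofReal (Real.log 2) * ENNReal.ofReal h
        = expect p fun _ => ENNReal.ofReal (1 + h * Real.log 2) := by
          rw [expect_const, ENNReal.ofReal_add (by norm_num) (by positivity), ENNReal.ofReal_one,
            mul_comm h, ENNReal.ofReal_mul hl.le]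
      _ ≤ expect p fun x => ENNReal.ofReal ((2 : ℝ) ^ h) *
            ENNReal.ofReal ((1 / 2 : ℝ) ^ (φ x).length) +
            ENNReal.ofReal (Real.log 2) * ((φ x).length : ℝ≥0∞) := by
          refine expect_mono_support fun x _ => ?_
          rw [← ENNReal.ofReal_natCast, ← ENNReal.ofReal_mul (by positivity),
            ← ENNReal.ofReal_mul hl.le, ← ENNReal.ofReal_add (by positivity) (by positivity)]
          exact ENNReal.ofReal_le_ofReal (one_add_mul_log_two_le h _)
      _ = expect p (fun x => ENNReal.ofReal ((2 : ℝ) ^ h) *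
            ENNReal.ofReal ((1 / 2 : ℝ) ^ (φ x).length)) +
            ENNReal.ofReal (Real.log 2) * rate p φ := by
          rw [expect_add, expect_const_mul p (ENNReal.ofReal (Real.log 2)), rate_eq_expect]
      _ ≤ _ := by
          gcongr
          -- As `p x ≤ 2^(-h)`, the factor `2^h` cancels and the Kraft sum over `s` remains, which
          -- is at most 1.
          have hsub : Function.support (fun x => p x * (ENNReal.ofReal ((2 : ℝ) ^ h) *
              ENNReal.ofReal ((1 / 2 : ℝ) ^ (φ x).length))) ⊆ s := by
            intro x hx
            exact hs (left_ne_zero_of_mul hx)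
          unfold expect
          rw [← tsum_subtype_eq_of_support_subset hsub]
          refine (ENNReal.tsum_le_tsum fun x => ?_).trans (kraft_tsum hφ)
          calc p x * (ENNReal.ofReal ((2 : ℝ) ^ h) * ENNReal.ofReal ((1 / 2 : ℝ) ^ (φ x).length))
              ≤ ENNReal.ofReal ((2 : ℝ) ^ (-h)) * (ENNReal.ofReal ((2 : ℝ) ^ h) *
                  ENNReal.ofReal ((1 / 2 : ℝ) ^ (φ x).length)) := by gcongr; exact hp x
            _ = _ := by
                rw [← mul_assoc, ← ENNReal.ofReal_mul (by positivity),
                  ← Real.rpow_add (by norm_num)]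
                simp
  have h2 := (ENNReal.add_le_add_iff_left (by simp)).1 key
  exact (ENNReal.mul_le_mul_iff_right (by simpa using hl) (by simp)).1 h2

lemma optimalRate_le {α : Type*} {p : PMF α} {φ : α → List Bool}
    (hφ : PrefixFreeOn p.support φ) : optimalRate p ≤ rate p φ :=
  iInf₂_le φ hφ

lemma PrefixFreeOn.mono {α : Type*} {s t : Set α} {φ : α → List Bool} (h : PrefixFreeOn t φ)
    (hst : s ⊆ t) : PrefixFreeOn s φ :=
  fun x hx y hy => h x (hst hx) y (hst hy)

/-- Conditioning lowers the rate: a bound given the side information holds on average. -/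
lemma expect_le_optimalRate_bind {α β : Type*} (q : PMF β) (k : β → PMF α) (h : β → ℝ)
    (hk : ∀ v ∈ q.support, ∀ x, k v x ≤ ENNReal.ofReal ((2 : ℝ) ^ (-(h v)))) :
    expect q (fun v => ENNReal.ofReal (h v)) ≤ optimalRate (q.bind k) := by
  refine le_iInf₂ fun φ hφ => ?_
  rw [rate_eq_expect, expect_bind]
  refine expect_mono_support fun v hv => ?_
  -- The code is prefix-free on the support of the mixture, hence serves for every conditional law.
  refine le_rate_of_forall_le (s := (q.bind k).support) ?_ hφ (hk v hv)
  rw [PMF.support_bind]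
  exact Set.subset_biUnion_of_mem (u := fun a => (k a).support) hv

/-- A source with at least two values has rate at least one. -/
lemma one_le_optimalRate {α : Type*} {p : PMF α} {x y : α} (hx : x ∈ p.support)
    (hy : y ∈ p.support) (hxy : x ≠ y) : 1 ≤ optimalRate p := by
  refine le_iInf₂ fun φ hφ => ?_
  have h1 : expect p (fun _ => 1) ≤ rate p φ := by
    refine expect_mono_support fun z hz => ?_
    have : φ z ≠ [] := by
      intro h0
      have h := fun w hw => hφ z hz w hw (h0 ▸ List.nil_prefix)
      exact hxy ((h x hx).symm.trans (h y hy))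
    exact_mod_cast List.length_pos_iff.2 this
  rwa [expect_const] at h1

/-! ### Variable-length deduplication is a prefix-free code -/

/-- The last two clauses make a chunk self-delimiting when it is written out in full: it stops at
the first anchor, or else the string is exhausted. -/
lemma chunksAux_cons (M : ℕ) (cur : List Bool) {s : List Bool} (hs : s ≠ []) :
    ∃ z t, s = z ++ t ∧ z ≠ [] ∧ chunksAux M cur s = (cur ++ z) :: chunks M t ∧
      (∀ u, u <+: z → u ≠ [] → u ≠ z → ¬ List.replicate M false <:+ cur ++ u) ∧
      (List.replicate M false <:+ cur ++ z ∨ t = []) := by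
  induction s generalizing cur with
  | nil => exact absurd rfl hs
  | cons b s ih =>
    by_cases hb : List.replicate M false <:+ cur ++ [b]
    · refine ⟨[b], s, rfl, by simp, by rw [chunksAux, if_pos hb]; rfl, ?_, Or.inl hb⟩
      intro u hu h0 h1
      rcases List.prefix_cons_iff.1 hu with h | ⟨t, rfl, ht⟩
      · exact absurd h h0
      · exact absurd (by rw [List.prefix_nil.1 ht]) h1
    · by_cases hs' : s = []
      · subst hs'
        refine ⟨[b], [], rfl, by simp, ?_, ?_, Or.inr rfl⟩
        · rw [chunksAux, if_neg hb]
          simp [chunksAux, chunks]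
        · intro u hu h0 h1
          rcases List.prefix_cons_iff.1 hu with h | ⟨t, rfl, ht⟩
          · exact absurd h h0
          · exact absurd (by rw [List.prefix_nil.1 ht]) h1
      · obtain ⟨z, t, h1, h2, h3, h4, h5⟩ := ih (cur ++ [b]) hs'
        refine ⟨b :: z, t, by rw [h1]; rfl, by simp, ?_, ?_, ?_⟩
        · rw [chunksAux, if_neg hb, h3]
          simp
        · intro u hu h0 hne
          rcases List.prefix_cons_iff.1 hu with h | ⟨v, rfl, hv⟩
          · exact absurd h h0
          · by_cases hv0 : v = []
            · subst hv0
              exact hb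
            · have := h4 v hv hv0 (fun h => hne (by rw [h]))
              simpa using this
        · simpa using h5

lemma chunks_cons (M : ℕ) {s : List Bool} (hs : s ≠ []) :
    ∃ z t, s = z ++ t ∧ z ≠ [] ∧ chunks M s = z :: chunks M t ∧
      (∀ u, u <+: z → u ≠ [] → u ≠ z → ¬ List.replicate M false <:+ u) ∧
      (List.replicate M false <:+ z ∨ t = []) := by
  simpa [chunks] using chunksAux_cons M [] hs

lemma length_toBits (w n : ℕ) : (toBits w n).length = w := by simp [toBits]

lemma toBits_injOn {w m n : ℕ} (hm : m < 2 ^ w) (hn : n < 2 ^ w) (h : toBits w m = toBits w n) :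
    m = n := by
  have h' := List.ofFn_injective h
  refine Nat.eq_of_testBit_eq fun i => ?_
  by_cases hi : i < w
  · have := congrFun h' ⟨w - 1 - i, by omega⟩
    simp only at this
    rwa [show w - 1 - (w - 1 - i) = i by omega] at this
  · have hle : 2 ^ w ≤ 2 ^ i := Nat.pow_le_pow_right (by norm_num) (by omega)
    rw [Nat.testBit_lt_two_pow (hm.trans_le hle), Nat.testBit_lt_two_pow (hn.trans_le hle)]

lemma eq_of_append_prefix_append {α : Type*} {u v e e' : List α} (h : u ++ e <+: v ++ e')
    (hl : u.length = v.length) : u = v ∧ e <+: e' := by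
  obtain ⟨t, ht⟩ := h
  rw [List.append_assoc] at ht
  have := List.append_inj ht hl
  exact ⟨this.1, t, this.2⟩

lemma prefix_or_prefix_of_append {α : Type*} {u v e e' : List α} (h : u ++ e <+: v ++ e') :
    u <+: v ∨ v <+: u :=
  List.prefix_or_prefix_of_prefix ((List.prefix_append u e).trans h) (List.prefix_append v e')

/-- The decoder rebuilds the dictionary step by step, so the induction runs over all dictionaries.
Equal lengths are assumed because the last chunk may lack an anchor; its end is then known only from
the total length. -/
lemma encodeChunks_injective (M : ℕ) (n : ℕ) : ∀ (dict : List (List Bool)) (s s' : List Bool),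
    s.length = n → s'.length = n →
    encodeChunks dict (chunks M s) <+: encodeChunks dict (chunks M s') → s = s' := by
  induction n using Nat.strong_induction_on with
  | _ n ih =>
  intro dict s s' hs hs' h
  by_cases h0 : s = []
  · subst h0
    exact (List.length_eq_zero_iff.1 (hs'.trans hs.symm)).symm
  have h0' : s' ≠ [] := by
    rintro rfl
    exact h0 (List.length_eq_zero_iff.1 (hs.trans hs'.symm))
  obtain ⟨z, t, rfl, hz, hc, hpre, hend⟩ := chunks_cons M h0
  obtain ⟨z', t', rfl, hz', hc', hpre', hend'⟩ := chunks_cons M h0'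
  rw [List.length_append] at hs hs'
  have hzl := List.length_pos_iff.2 hz
  have finish : ∀ dict', z = z' →
      encodeChunks dict' (chunks M t) <+: encodeChunks dict' (chunks M t') →
      z ++ t = z' ++ t' := by
    rintro dict' rfl ht
    rw [ih t.length (by omega) dict' t t' rfl (by omega) ht]
  rw [hc, hc', encodeChunks, encodeChunks] at h
  split_ifs at h with h1 h2 h2
  · obtain ⟨he, ht⟩ := eq_of_append_prefix_append (List.cons_prefix_cons.1 h).2
      (by simp [length_toBits])
    have hlt : ∀ {x : List Bool}, x ∈ dict → dict.idxOf x < 2 ^ Nat.clog 2 dict.length :=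
      fun hx => (List.idxOf_lt_length_iff.2 hx).trans_le (Nat.le_pow_clog (by norm_num) _)
    exact finish dict ((List.idxOf_inj h1).1 (toBits_injOn (hlt h1) (hlt h2) he)) ht
  · simp [List.cons_prefix_cons] at h
  · simp [List.cons_prefix_cons] at h
  · have h3 := (List.cons_prefix_cons.1 h).2
    have hzz : z = z' := by
      by_contra hne
      -- One of two different new chunks would be a proper prefix of the other. If the shorter one
      -- ends in the anchor, the longer one would have been cut earlier; if it exhausts its string,
      -- the common length leaves no room for the longer one.
      rcases prefix_or_prefix_of_append h3 with hp | hp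
      · rcases hend with he | rfl
        · exact hpre' z hp hz hne he
        · have hle := hp.length_le
          exact hne (hp.eq_of_length (by simp at hs; omega))
      · rcases hend' with he | rfl
        · exact hpre z' hp hz' (Ne.symm hne) he
        · have hle := hp.length_le
          exact hne (hp.eq_of_length (by simp at hs'; omega)).symm
    subst hzz
    exact finish (dict ++ [z]) rfl (eq_of_append_prefix_append h3 rfl).2

lemma prefixFreeOn_encodeVL {γ : ℕ → List Bool} (hγ : PrefixFreeOn {n : ℕ | 1 ≤ n} γ) (M : ℕ) :
    PrefixFreeOn {s | s ≠ []} (encodeVL γ M) := by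
  intro s hs s' hs' h
  have hl := List.length_pos_iff.2 hs
  have hl' := List.length_pos_iff.2 hs'
  have hlen : s.length = s'.length := by
    rcases prefix_or_prefix_of_append h with hp | hp
    · exact hγ _ hl _ hl' hp
    · exact (hγ _ hl' _ hl hp).symm
  unfold encodeVL at h
  exact encodeChunks_injective M s'.length [] s s' hlen rfl
    (eq_of_append_prefix_append h (by rw [hlen])).2

/-! ### Pointwise analysis of the chunking -/

/-- The number of chunk ends met while reading a string, if the current chunk ends with exactly
`r` zeros at the start. -/
def hits (M : ℕ) : ℕ → List Bool → ℕ
  | _, [] => 0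
  | _, true :: x => hits M 0 x
  | r, false :: x => if r + 1 = M then 1 + hits M 0 x else hits M (r + 1) x

/-- The number of bits read until the first chunk end (or the end of the string), if the current
chunk ends with exactly `r` zeros at the start. -/
def firstHit (M : ℕ) : ℕ → List Bool → ℕ
  | _, [] => 0
  | _, true :: x => 1 + firstHit M 0 x
  | r, false :: x => if r + 1 = M then 1 else 1 + firstHit M (r + 1) x

/-- The number of bits read until the first chunk end after the first 1. From there on, the
chunking of a string does not depend on what precedes the string. -/
def syncTime (M : ℕ) : List Bool → ℕ
  | [] => 0
  | true :: x => 1 + firstHit M 0 x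
  | false :: x => 1 + syncTime M x

/-- The number of nonempty suffixes without an anchor. -/
def freeSuffixes (M : ℕ) : List Bool → ℕ
  | [] => 0
  | b :: x => (if hits M 0 (b :: x) = 0 then 1 else 0) + freeSuffixes M x

/-- The chunks completed while reading a string, starting with the partial chunk `cur`. -/
def emit (M : ℕ) : List Bool → List Bool → List (List Bool)
  | _, [] => []
  | cur, b :: x =>
    if List.replicate M false <:+ cur ++ [b] then (cur ++ [b]) :: emit M [] x
    else emit M (cur ++ [b]) x

/-- The partial chunk left after reading a string, starting with the partial chunk `cur`. -/
def leftover (M : ℕ) : List Bool → List Bool → List Bool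
  | cur, [] => cur
  | cur, b :: x =>
    if List.replicate M false <:+ cur ++ [b] then leftover M [] x
    else leftover M (cur ++ [b]) x

/-- The total length of a list of strings. -/
def totalLength (l : List (List Bool)) : ℕ := (l.map List.length).sum

/-- The chunks of a block that do not depend on what precedes the block. -/
def innerChunks (M : ℕ) (x : List Bool) : List (List Bool) := emit M [] (x.drop (syncTime M x))

/-- The string `cur` ends with exactly `r` zeros. -/
def EndsWithZeros (r : ℕ) (cur : List Bool) : Prop :=
  ∃ u, cur = u ++ List.replicate r false ∧ (u = [] ∨ ∃ v, u = v ++ [true])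

lemma totalLength_append (l l' : List (List Bool)) :
    totalLength (l ++ l') = totalLength l + totalLength l' := by simp [totalLength]

lemma totalLength_cons (z : List Bool) (l : List (List Bool)) :
    totalLength (z :: l) = z.length + totalLength l := by simp [totalLength]

lemma endsWithZeros_nil : EndsWithZeros 0 [] := ⟨[], by simp⟩

lemma endsWithZeros_append_true (cur : List Bool) : EndsWithZeros 0 (cur ++ [true]) :=
  ⟨cur ++ [true], by simp⟩

lemma EndsWithZeros.append_false {r : ℕ} {cur : List Bool} (h : EndsWithZeros r cur) :
    EndsWithZeros (r + 1) (cur ++ [false]) := by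
  obtain ⟨u, rfl, hu⟩ := h
  exact ⟨u, by simp [List.replicate_succ'], hu⟩

lemma not_replicate_suffix_append_true {M : ℕ} (hM : 1 ≤ M) (cur : List Bool) :
    ¬ List.replicate M false <:+ cur ++ [true] := by
  obtain ⟨m, rfl⟩ := Nat.exists_eq_succ_of_ne_zero (by omega : M ≠ 0)
  rintro ⟨t, ht⟩
  rw [List.replicate_succ', ← List.append_assoc] at ht
  have := (List.append_inj' ht rfl).2
  simp at this

/-- Just before the run of exactly `r` zeros there is a 1 or the start of the chunk, so a longer
anchor cannot fit. This replaces the suffix test by a counter with `M` states. -/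
lemma EndsWithZeros.replicate_suffix_iff {M r : ℕ} {cur : List Bool} (h : EndsWithZeros r cur)
    (hr : r < M) : List.replicate M false <:+ cur ++ [false] ↔ r + 1 = M := by
  obtain ⟨u, rfl, hu⟩ := h
  constructor
  · rintro ⟨t, ht⟩
    by_contra hne
    obtain ⟨k, rfl⟩ : ∃ k, M = (k + 1) + (r + 1) := ⟨M - r - 2, by omega⟩
    rw [List.append_assoc, ← List.replicate_succ', List.replicate_add, ← List.append_assoc] at ht
    have h1 := (List.append_inj' ht (by simp)).1
    rcases hu with rfl | ⟨v, rfl⟩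
    · simp at h1
    · exact not_replicate_suffix_append_true (by omega) v ⟨t, h1⟩
  · rintro rfl
    exact ⟨u, by simp [List.replicate_succ']⟩

/-- Compare two counters on the same input. When the one that is ahead closes a chunk it falls back
to 0 and the other one leads; this exchange of roles is why both inequalities are proved together.
-/
lemma hits_mono_and_le {M : ℕ} (x : List Bool) : ∀ {r r' : ℕ}, r' ≤ r → r < M →
    hits M r' x ≤ hits M r x ∧ hits M r x ≤ hits M r' x + 1 := by
  induction x with
  | nil => simp [hits]
  | cons b x ih =>
    intro r r' h hr
    cases b with
    | true => simp [hits]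
    | false =>
      simp only [hits]
      split_ifs with h1 h2 h2
      · omega
      · have := ih (Nat.zero_le (r + 1)) (by omega)
        omega
      · have := ih (Nat.zero_le (r' + 1)) (by omega)
        omega
      · exact ih (by omega) (by omega)

lemma hits_append_le {M : ℕ} (x y : List Bool) : ∀ {r : ℕ}, r < M →
    hits M r (x ++ y) ≤ hits M r x + (1 + hits M 0 y) := by
  induction x with
  | nil =>
    intro r hr
    have := (hits_mono_and_le y (Nat.zero_le r) hr).2
    simp only [List.nil_append, hits]
    omega
  | cons b x ih =>
    intro r hr
    cases b with
    | true => exact ih (by omega)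
    | false =>
      simp only [List.cons_append, hits]
      split_ifs with h1
      · have := @ih 0 (by omega)
        omega
      · exact ih (by omega)

lemma hits_le_length (M : ℕ) (x : List Bool) : ∀ r, hits M r x ≤ x.length := by
  induction x with
  | nil => simp [hits]
  | cons b x ih =>
    intro r
    have h0 := ih 0
    have h1 := ih (r + 1)
    cases b
    · simp only [hits, List.length_cons]
      split_ifs <;> omega
    · simp only [hits, List.length_cons]
      omega

lemma hits_flatten_le {M : ℕ} (hM : 1 ≤ M) (Y : List (List Bool)) :
    hits M 0 Y.flatten ≤ Y.length + (Y.map (hits M 0)).sum := by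
  induction Y with
  | nil => simp [hits]
  | cons x Y ih =>
    have := hits_append_le x Y.flatten (M := M) (r := 0) hM
    simp only [List.flatten_cons, List.map_cons, List.sum_cons, List.length_cons]
    omega

/-! ### Emitted chunks and the partial chunk left over -/

lemma chunksAux_append (M : ℕ) (x s : List Bool) : ∀ cur,
    chunksAux M cur (x ++ s) = emit M cur x ++ chunksAux M (leftover M cur x) s := by
  induction x with
  | nil => simp [emit, leftover]
  | cons b x ih =>
    intro cur
    simp only [List.cons_append, chunksAux, emit, leftover]
    split_ifs
    · rw [ih, List.cons_append]
    · rw [ih]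

lemma length_emit {M : ℕ} (hM : 1 ≤ M) (x : List Bool) : ∀ {r : ℕ} {cur : List Bool},
    EndsWithZeros r cur → r < M → (emit M cur x).length = hits M r x := by
  induction x with
  | nil => simp [emit, hits]
  | cons b x ih =>
    intro r cur h hr
    cases b with
    | true =>
      rw [emit, if_neg (not_replicate_suffix_append_true hM cur), hits]
      exact ih (endsWithZeros_append_true cur) (by omega)
    | false =>
      rw [emit, hits]
      simp only [h.replicate_suffix_iff hr]
      split_ifs with h1
      · rw [List.length_cons, ih endsWithZeros_nil (by omega), add_comm]
      · exact ih h.append_false (by omega)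

lemma leftover_endsWithZeros {M : ℕ} (hM : 1 ≤ M) (x : List Bool) : ∀ {r : ℕ} {cur : List Bool},
    EndsWithZeros r cur → r < M → ∃ r', EndsWithZeros r' (leftover M cur x) ∧ r' < M := by
  induction x with
  | nil => exact fun h hr => ⟨_, h, hr⟩
  | cons b x ih =>
    intro r cur h hr
    cases b with
    | true =>
      rw [leftover, if_neg (not_replicate_suffix_append_true hM cur)]
      exact ih (endsWithZeros_append_true cur) (by omega)
    | false =>
      rw [leftover]
      simp only [h.replicate_suffix_iff hr]
      split_ifs with h1
      · exact ih endsWithZeros_nil (by omega)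
      · exact ih h.append_false (by omega)

lemma totalLength_emit (M : ℕ) (x : List Bool) : ∀ cur,
    totalLength (emit M cur x) + (leftover M cur x).length = cur.length + x.length := by
  induction x with
  | nil => simp [emit, leftover, totalLength]
  | cons b x ih =>
    intro cur
    simp only [emit, leftover]
    split_ifs
    · have := ih []
      simp only [totalLength_cons, List.length_append, List.length_cons, List.length_nil] at this ⊢
      omega
    · have := ih (cur ++ [b])
      simp only [List.length_append, List.length_cons, List.length_nil] at this ⊢
      omega

lemma length_chunks_le {M : ℕ} (hM : 1 ≤ M) (s : List Bool) :
    (chunks M s).length ≤ hits M 0 s + 1 := by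
  have h := chunksAux_append M s [] []
  rw [List.append_nil] at h
  rw [chunks, h, List.length_append, length_emit hM s endsWithZeros_nil (by omega)]
  simp only [chunksAux]
  split_ifs <;> simp

lemma emit_eq_append_of_firstHit {M : ℕ} (hM : 1 ≤ M) (x : List Bool) :
    ∀ {r : ℕ} {cur : List Bool}, EndsWithZeros r cur → r < M →
      ∃ l, emit M cur x = l ++ emit M [] (x.drop (firstHit M r x)) := by
  induction x with
  | nil => simp [emit]
  | cons b x ih =>
    intro r cur h hr
    cases b with
    | true =>
      rw [emit, if_neg (not_replicate_suffix_append_true hM cur), firstHit, add_comm 1,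
        List.drop_succ_cons]
      exact ih (endsWithZeros_append_true cur) (by omega)
    | false =>
      rw [emit, firstHit]
      simp only [h.replicate_suffix_iff hr]
      split_ifs with h1
      · exact ⟨[cur ++ [false]], rfl⟩
      · rw [add_comm 1, List.drop_succ_cons]
        exact ih h.append_false (by omega)

/-- The first 1 resets the count of zeros to 0 for every history, so the next chunk end falls at the
same place for all of them. There the partial chunk is empty and nothing of the history is left. -/
lemma emit_eq_append_innerChunks {M : ℕ} (hM : 1 ≤ M) (x : List Bool) :
    ∀ {r : ℕ} {cur : List Bool}, EndsWithZeros r cur → r < M →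
      ∃ l, emit M cur x = l ++ innerChunks M x := by
  unfold innerChunks
  induction x with
  | nil => simp [emit]
  | cons b x ih =>
    intro r cur h hr
    cases b with
    | true =>
      rw [emit, if_neg (not_replicate_suffix_append_true hM cur), syncTime, add_comm 1,
        List.drop_succ_cons]
      exact emit_eq_append_of_firstHit hM x (endsWithZeros_append_true cur) (by omega)
    | false =>
      rw [emit, syncTime, add_comm 1, List.drop_succ_cons]
      simp only [h.replicate_suffix_iff hr]
      split_ifs with h1
      · obtain ⟨l, hl⟩ := ih endsWithZeros_nil (by omega)
        exact ⟨(cur ++ [false]) :: l, by rw [hl]; rfl⟩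
      · exact ih h.append_false (by omega)

/-- An unfinished chunk contains no anchor, nor do its suffixes, so each of its bits read from `x`
starts a suffix counted by `freeSuffixes`. The old bits `cur` survive only if no chunk ends in `x`.
-/
lemma length_leftover_le {M : ℕ} (hM : 1 ≤ M) (x : List Bool) :
    ∀ {r : ℕ} {cur : List Bool}, EndsWithZeros r cur → r < M →
      (leftover M cur x).length ≤ (if hits M r x = 0 then cur.length else 0) + freeSuffixes M x := by
  induction x with
  | nil => simp [leftover, hits, freeSuffixes]
  | cons b x ih =>
    intro r cur h hr
    -- No chunk end from state `r` implies none from state 0, the state used by `freeSuffixes`.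
    have hmono := (hits_mono_and_le (b :: x) (Nat.zero_le r) hr).1
    rw [freeSuffixes]
    have key : ∀ r', hits M r (b :: x) = hits M r' x → EndsWithZeros r' (cur ++ [b]) → r' < M →
        (leftover M (cur ++ [b]) x).length ≤ (if hits M r (b :: x) = 0 then cur.length else 0) +
          ((if hits M 0 (b :: x) = 0 then 1 else 0) + freeSuffixes M x) := by
      intro r' h1 h2 h3
      have := ih h2 h3
      rw [← h1, List.length_append, List.length_singleton] at this
      split_ifs at this ⊢ <;> omega
    cases b with
    | true =>
      rw [leftover, if_neg (not_replicate_suffix_append_true hM cur)]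
      exact key 0 rfl (endsWithZeros_append_true cur) (by omega)
    | false =>
      rw [leftover]
      simp only [h.replicate_suffix_iff hr]
      by_cases h1 : r + 1 = M
      · rw [if_pos h1]
        have := ih endsWithZeros_nil (by omega : 0 < M)
        simp only [List.length_nil, ite_self, zero_add] at this
        omega
      · rw [if_neg h1]
        exact key (r + 1) (by rw [hits, if_neg h1]) h.append_false (by omega)

lemma freeSuffixes_drop_le (M : ℕ) (x : List Bool) : ∀ k,
    freeSuffixes M (x.drop k) ≤ freeSuffixes M x := by
  induction x with
  | nil => simp
  | cons b x ih =>
    intro k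
    cases k with
    | zero => simp
    | succ k =>
      rw [List.drop_succ_cons, freeSuffixes]
      exact (ih k).trans (Nat.le_add_left _ _)

lemma firstHit_le_length (M : ℕ) (x : List Bool) : ∀ r, firstHit M r x ≤ x.length := by
  induction x with
  | nil => simp [firstHit]
  | cons b x ih =>
    intro r
    have h0 := ih 0
    have h1 := ih (r + 1)
    cases b
    · simp only [firstHit, List.length_cons]
      split_ifs <;> omega
    · simp only [firstHit, List.length_cons]
      omega

lemma syncTime_le_length (M : ℕ) (x : List Bool) : syncTime M x ≤ x.length := by
  induction x with
  | nil => simp [syncTime]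
  | cons b x ih =>
    have h0 := firstHit_le_length M x 0
    cases b <;> simp only [syncTime, List.length_cons] <;> omega

lemma totalLength_innerChunks_le (M : ℕ) (x : List Bool) :
    totalLength (innerChunks M x) ≤ x.length := by
  have := totalLength_emit M (x.drop (syncTime M x)) []
  simp only [List.length_nil, List.length_drop] at this
  unfold innerChunks
  omega

lemma length_le_totalLength_innerChunks {M : ℕ} (hM : 1 ≤ M) (x : List Bool) :
    x.length ≤ totalLength (innerChunks M x) + (syncTime M x + freeSuffixes M x) := by
  have h1 := totalLength_emit M (x.drop (syncTime M x)) []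
  have h2 := length_leftover_le hM (x.drop (syncTime M x)) endsWithZeros_nil (by omega)
  have h3 := freeSuffixes_drop_le M x (syncTime M x)
  have h4 := syncTime_le_length M x
  simp only [List.length_nil, List.length_drop, ite_self] at h1 h2
  unfold innerChunks
  omega

/-- `E` collects the chunks, or parts of lists of chunks, that depend on the context of a block.
Since chunking conserves length, `E` occupies at most what the inner chunks, counted with
multiplicity, leave over. -/
lemma exists_outer_chunks {M : ℕ} (hM : 1 ≤ M) (Y : List (List Bool)) :
    ∀ {r : ℕ} {cur : List Bool}, EndsWithZeros r cur → r < M →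
      ∃ E : List (List Bool),
        (∀ z ∈ chunksAux M cur Y.flatten, z ∈ E ∨ ∃ x ∈ Y, z ∈ innerChunks M x) ∧
        totalLength E + (Y.map fun x => totalLength (innerChunks M x)).sum
          ≤ cur.length + Y.flatten.length := by
  induction Y with
  | nil =>
    intro r cur _ _
    refine ⟨[cur], ?_, by simp [totalLength]⟩
    intro z hz
    simp only [List.flatten_nil, chunksAux] at hz
    split_ifs at hz
    · simp at hz
    · exact Or.inl hz
  | cons x Y ih =>
    intro r cur h hr
    obtain ⟨r', h', hr'⟩ := leftover_endsWithZeros hM x h hr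
    obtain ⟨l, hl⟩ := emit_eq_append_innerChunks hM x h hr
    obtain ⟨E, hE, htot⟩ := ih h' hr'
    refine ⟨l ++ E, ?_, ?_⟩
    · intro z hz
      rw [List.flatten_cons, chunksAux_append, hl] at hz
      simp only [List.mem_append] at hz ⊢
      rcases hz with (hz | hz) | hz
      · exact Or.inl (Or.inl hz)
      · exact Or.inr ⟨x, by simp, hz⟩
      · rcases hE z hz with hz | ⟨y, hy, hz⟩
        · exact Or.inl (Or.inr hz)
        · exact Or.inr ⟨y, by simp [hy], hz⟩
    · have := totalLength_emit M x cur
      rw [hl, totalLength_append] at this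
      simp only [totalLength_append, List.map_cons, List.sum_cons, List.flatten_cons,
        List.length_append]
      omega

/-! ### Distinct chunks and the cost of the encoding -/

lemma sum_toFinset_length_le (l : List (List Bool)) :
    ∑ z ∈ l.toFinset, z.length ≤ totalLength l := by
  induction l with
  | nil => simp
  | cons z l ih =>
    rw [List.toFinset_cons, totalLength_cons]
    by_cases hz : z ∈ l.toFinset
    · rw [Finset.insert_eq_of_mem hz]
      omega
    · rw [Finset.sum_insert hz]
      omega

/-- Equal blocks have equal inner chunks, so these are charged once per distinct block, at most its
length. All other chunks are charged at every occurrence, and together they fit into the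
unsynchronized parts. -/
lemma sum_distinct_chunks_le {M : ℕ} (hM : 1 ≤ M) (Y : List (List Bool)) :
    ∑ z ∈ (chunks M Y.flatten).toFinset, z.length ≤
      ∑ x ∈ Y.toFinset, x.length + (Y.map fun x => syncTime M x + freeSuffixes M x).sum := by
  obtain ⟨E, hE, htot⟩ := exists_outer_chunks hM Y endsWithZeros_nil (by omega : 0 < M)
  have h1 : ∑ z ∈ (chunks M Y.flatten).toFinset, z.length ≤
      ∑ z ∈ E.toFinset ∪ Y.toFinset.biUnion (fun x => (innerChunks M x).toFinset), z.length := by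
    refine Finset.sum_le_sum_of_subset fun z hz => ?_
    simp only [Finset.mem_union, Finset.mem_biUnion, List.mem_toFinset] at hz ⊢
    exact hE z hz
  have h2 : ∑ z ∈ E.toFinset ∪ Y.toFinset.biUnion (fun x => (innerChunks M x).toFinset), z.length
      ≤ totalLength E + ∑ x ∈ Y.toFinset, x.length := by
    refine (le_self_add.trans (Finset.sum_union_inter (f := List.length)).le).trans ?_
    refine add_le_add (sum_toFinset_length_le E) ?_
    induction Y.toFinset using Finset.induction_on with
    | empty => simp
    | insert x s hx ih =>
      rw [Finset.biUnion_insert, Finset.sum_insert hx]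
      refine (le_self_add.trans (Finset.sum_union_inter (f := List.length)).le).trans ?_
      exact add_le_add ((sum_toFinset_length_le _).trans (totalLength_innerChunks_le M x)) ih
  have h3 : Y.flatten.length ≤ (Y.map fun x => totalLength (innerChunks M x)).sum +
      (Y.map fun x => syncTime M x + freeSuffixes M x).sum := by
    clear * - hM
    induction Y with
    | nil => simp
    | cons x Y ih =>
      have := length_le_totalLength_innerChunks hM x
      simp only [List.flatten_cons, List.length_append, List.map_cons, List.sum_cons]
      omega
  simp only [List.length_nil] at htot
  omega

/-- The dictionary never outgrows its initial size plus the number of chunks, which bounds all index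
widths at once. The flag of a new chunk is absorbed in the same per-chunk term. -/
lemma length_encodeChunks_le (zs : List (List Bool)) : ∀ dict : List (List Bool),
    (encodeChunks dict zs).length ≤ ∑ z ∈ zs.toFinset \ dict.toFinset, z.length +
      zs.length * (1 + Nat.clog 2 (dict.length + zs.length)) := by
  induction zs with
  | nil => simp [encodeChunks]
  | cons z zs ih =>
    intro dict
    rw [encodeChunks]
    split_ifs with hz
    · have h1 := ih dict
      have h2 : zs.toFinset \ dict.toFinset = (z :: zs).toFinset \ dict.toFinset := by
        rw [List.toFinset_cons, Finset.insert_sdiff_of_mem _ (by simpa using hz)]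
      have h3 : Nat.clog 2 (dict.length + zs.length) ≤ Nat.clog 2 (dict.length + (z :: zs).length) :=
        Nat.clog_mono_right _ (by simp)
      have h4 : Nat.clog 2 dict.length ≤ Nat.clog 2 (dict.length + (z :: zs).length) :=
        Nat.clog_mono_right _ (by simp)
      rw [h2] at h1
      simp only [List.length_cons, List.length_append, length_toBits] at h3 h4 ⊢
      have h5 := Nat.mul_le_mul_left zs.length (Nat.add_le_add_left h3 1)
      rw [add_mul zs.length 1]
      omega
    · have h1 := ih (dict ++ [z])
      have h2 : (z :: zs).toFinset \ dict.toFinset =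
          insert z (zs.toFinset \ (dict ++ [z]).toFinset) := by
        ext w
        simp only [List.toFinset_cons, List.toFinset_append, List.toFinset_nil, Finset.mem_sdiff,
          Finset.mem_insert, Finset.mem_union, List.mem_toFinset, insert_empty_eq,
          Finset.mem_singleton]
        by_cases hw : w = z
        · subst hw
          simp [hz]
        · simp [hw]
      have h3 : z ∉ zs.toFinset \ (dict ++ [z]).toFinset := by simp
      rw [h2, Finset.sum_insert h3]
      simp only [List.length_cons, List.length_append, List.length_nil, zero_add] at h1 ⊢
      rw [show dict.length + 1 + zs.length = dict.length + (zs.length + 1) by ring] at h1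
      rw [add_mul zs.length 1]
      omega

/-- Variable-length deduplication spends at most the lengths of the distinct blocks, the parts of
the blocks that are not synchronized, and the costs of the chunk indices. -/
lemma length_encodeVL_le (γ : ℕ → List Bool) {M : ℕ} (hM : 1 ≤ M) (Y : List (List Bool)) :
    (encodeVL γ M Y.flatten).length ≤ (γ Y.flatten.length).length +
      (∑ x ∈ Y.toFinset, x.length + (Y.map fun x => syncTime M x + freeSuffixes M x).sum) +
      (1 + Y.length + (Y.map (hits M 0)).sum) * (1 + Nat.clog 2 (Y.flatten.length + 1)) := by
  have h1 := length_encodeChunks_le (chunks M Y.flatten) []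
  have h2 := sum_distinct_chunks_le hM Y
  have h3 := length_chunks_le hM Y.flatten
  have h4 := hits_flatten_le hM Y
  have h5 := hits_le_length M Y.flatten 0
  simp only [List.toFinset_nil, Finset.sdiff_empty, List.length_nil, zero_add] at h1
  have h6 : (chunks M Y.flatten).length * (1 + Nat.clog 2 (chunks M Y.flatten).length) ≤
      (1 + Y.length + (Y.map (hits M 0)).sum) * (1 + Nat.clog 2 (Y.flatten.length + 1)) :=
    Nat.mul_le_mul (by omega) (Nat.add_le_add_left (Nat.clog_mono_right _ (by omega)) 1)
  rw [encodeVL, List.length_append]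
  omega

/-! ### Averages over all strings of a given length -/

lemma mem_strings {n : ℕ} {x : List Bool} : x ∈ strings n ↔ x.length = n := by
  constructor
  · intro h
    obtain ⟨f, -, rfl⟩ := Finset.mem_image.1 h
    simp
  · rintro rfl
    exact Finset.mem_image.2 ⟨x.get, Finset.mem_univ _, List.ofFn_get x⟩

lemma card_strings (n : ℕ) : (strings n).card = 2 ^ n := by
  rw [strings, Finset.card_image_of_injective _ List.ofFn_injective]
  simp

lemma sum_strings_zero (f : List Bool → ℕ) : ∑ x ∈ strings 0, f x = f [] := by
  have : strings 0 = {[]} := by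
    ext x
    simp [mem_strings]
  simp [this]

lemma sum_strings_succ (n : ℕ) (f : List Bool → ℕ) :
    ∑ x ∈ strings (n + 1), f x =
      ∑ x ∈ strings n, f (true :: x) + ∑ x ∈ strings n, f (false :: x) := by
  have h : strings (n + 1) =
      (strings n).image (List.cons true) ∪ (strings n).image (List.cons false) := by
    ext x
    simp only [Finset.mem_union, Finset.mem_image, mem_strings]
    cases x with
    | nil => simp
    | cons b x => cases b <;> simp
  have hd : Disjoint ((strings n).image (List.cons true)) ((strings n).image (List.cons false)) := by
    rw [Finset.disjoint_left]
    intro x hx hx'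
    obtain ⟨y, -, rfl⟩ := Finset.mem_image.1 hx
    obtain ⟨z, -, hz⟩ := Finset.mem_image.1 hx'
    simp at hz
  rw [h, Finset.sum_union hd, Finset.sum_image (by simp), Finset.sum_image (by simp)]

lemma sum_strings_one_add (n : ℕ) (f : List Bool → ℕ) :
    ∑ x ∈ strings n, (1 + f x) = 2 ^ n + ∑ x ∈ strings n, f x := by
  rw [Finset.sum_add_distrib, Finset.sum_const, card_strings, smul_eq_mul, mul_one]

lemma sum_firstHit_succ (M n r : ℕ) : ∑ x ∈ strings (n + 1), firstHit M r x =
    2 ^ n + ∑ x ∈ strings n, firstHit M 0 x +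
      (2 ^ n + if r + 1 = M then 0 else ∑ x ∈ strings n, firstHit M (r + 1) x) := by
  rw [sum_strings_succ]
  simp only [firstHit]
  rw [sum_strings_one_add]
  split_ifs with h
  · simp [card_strings]
  · rw [sum_strings_one_add]

/-- The mean waiting time for `M` zeros from state `r` solves `h r = 1 + (h 0 + h (r + 1)) / 2` with
`h M = 0`, so `h r = 2^(M+1) - 2^(r+1)`; truncation at `n` bits only lowers it. The bound is scaled
by `2^n` and freed of subtraction. -/
lemma sum_firstHit_add_le {M : ℕ} (hM : 1 ≤ M) (n : ℕ) : ∀ r, r < M →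
    ∑ x ∈ strings n, firstHit M r x + 2 ^ n * 2 ^ (r + 1) ≤ 2 ^ n * 2 ^ (M + 1) := by
  induction n with
  | zero =>
    intro r hr
    rw [sum_strings_zero]
    simpa [firstHit] using Nat.pow_le_pow_right (by norm_num : 0 < 2) (by omega : r + 1 ≤ M + 1)
  | succ n ih =>
    intro r hr
    rw [sum_firstHit_succ]
    have h0 := ih 0 (by omega)
    split_ifs with h
    · subst h
      have e1 : 2 ^ (n + 1) * 2 ^ (r + 1) = 2 * (2 ^ n * 2 ^ (r + 1)) := by ring
      have e2 : 2 ^ n * 2 ^ (r + 1 + 1) = 2 * (2 ^ n * 2 ^ (r + 1)) := by ring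
      have e3 : 2 ^ (n + 1) * 2 ^ (r + 1 + 1) = 4 * (2 ^ n * 2 ^ (r + 1)) := by ring
      omega
    · have h1 := ih (r + 1) (by omega)
      have e1 : 2 ^ (n + 1) * 2 ^ (r + 1) = 2 * (2 ^ n * 2 ^ (r + 1)) := by ring
      have e2 : 2 ^ n * 2 ^ (r + 1 + 1) = 2 * (2 ^ n * 2 ^ (r + 1)) := by ring
      have e3 : 2 ^ (n + 1) * 2 ^ (M + 1) = 2 * (2 ^ n * 2 ^ (M + 1)) := by ring
      omega

/-- Waiting for a 1 takes 2 bits on average, and `2 + h 0 = 2^(M+1)`. -/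
lemma sum_syncTime_le {M : ℕ} (hM : 1 ≤ M) (n : ℕ) :
    ∑ x ∈ strings n, syncTime M x ≤ 2 ^ n * 2 ^ (M + 1) := by
  induction n with
  | zero => simp [sum_strings_zero, syncTime]
  | succ n ih =>
    rw [sum_strings_succ]
    simp only [syncTime, sum_strings_one_add]
    have h0 := sum_firstHit_add_le hM n 0 (by omega)
    have e3 : 2 ^ (n + 1) * 2 ^ (M + 1) = 2 * (2 ^ n * 2 ^ (M + 1)) := by ring
    omega

/-- A renewal estimate: each chunk end consumes `2^(M+1) - 2` bits on average, the mean waiting time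
from state 0, and `2^(r+1) - 2` is the head start that `r` zeros give. -/
lemma sum_hits_mul_add_le {M : ℕ} (hM : 1 ≤ M) (n : ℕ) : ∀ r, r < M →
    (2 ^ (M + 1) - 2) * ∑ x ∈ strings n, hits M r x + 2 ^ n * 2 ≤ 2 ^ n * (n + 2 ^ (r + 1)) := by
  induction n with
  | zero =>
    intro r hr
    have : 2 ^ 1 ≤ 2 ^ (r + 1) := Nat.pow_le_pow_right (by norm_num) (by omega)
    simpa [sum_strings_zero, hits] using this
  | succ n ih =>
    intro r hr
    rw [sum_strings_succ]
    simp only [hits]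
    have h0 := ih 0 (by omega)
    split_ifs with h
    · subst h
      rw [sum_strings_one_add]
      have h2 : 2 ≤ 2 ^ (r + 1 + 1) := Nat.le_self_pow (by omega) 2
      obtain ⟨D, hD⟩ := Nat.exists_eq_add_of_le h2
      have h3 : 2 ^ (r + 1) * 2 = 2 + D := by rw [← hD]; ring
      clear ih h2
      rw [hD, Nat.add_sub_cancel_left] at h0 ⊢
      simp only [zero_add, pow_one] at h0
      have e : 2 ^ (n + 1) * (n + 1 + 2 ^ (r + 1)) =
          2 * (2 ^ n * n) + 2 ^ n * 2 + 2 ^ n * (2 ^ (r + 1) * 2) := by ring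
      rw [e, h3, pow_succ 2 n]
      simp only [mul_add] at h0 ⊢
      rw [mul_comm D (2 ^ n)]
      omega
    · have h1 := ih (r + 1) (by omega)
      have e : 2 ^ (n + 1) = 2 * 2 ^ n := by ring
      have e' : 2 ^ (r + 1 + 1) = 2 * 2 ^ (r + 1) := by ring
      rw [e'] at h1
      rw [e]
      simp only [zero_add, pow_one] at h0
      nlinarith

lemma sum_hits_le {M : ℕ} (hM : 1 ≤ M) (n : ℕ) :
    2 ^ M * ∑ x ∈ strings n, hits M 0 x ≤ 2 ^ n * n := by
  have h := sum_hits_mul_add_le hM n 0 (by omega)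
  have h1 : 2 ^ 1 ≤ 2 ^ M := Nat.pow_le_pow_right (by norm_num) hM
  have h2 : 2 ^ M ≤ 2 ^ (M + 1) - 2 := by
    rw [pow_succ]
    omega
  have h3 := Nat.mul_le_mul_right (∑ x ∈ strings n, hits M 0 x) h2
  simp only [zero_add, pow_one, mul_add] at h
  omega

/-- One more bit at the end lengthens the wait by 1 exactly if there was no hit before. The
truncated difference `1 - hits M r x` is the indicator of that event. -/
lemma sum_firstHit_succ_eq (M n : ℕ) : ∀ r, ∑ x ∈ strings (n + 1), firstHit M r x =
    2 * ∑ x ∈ strings n, firstHit M r x + 2 * ∑ x ∈ strings n, (1 - hits M r x) := by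
  induction n with
  | zero =>
    intro r
    rw [sum_firstHit_succ]
    simp only [sum_strings_zero, firstHit, hits]
    simp
  | succ n ih =>
    intro r
    rw [sum_firstHit_succ M (n + 1) r, sum_firstHit_succ M n r, ih 0, ih (r + 1),
      sum_strings_succ n (fun x => 1 - hits M r x)]
    simp only [hits]
    have e : 2 ^ (n + 1) = 2 * 2 ^ n := by ring
    split_ifs with h
    · simp only [Nat.sub_add_eq, Nat.sub_self, Nat.zero_sub, Finset.sum_const_zero]
      omega
    · omega

/-- Let `q k` be the probability of no hit in `k` uniform bits. The mean of `firstHit` is the tail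
sum of `q k` over `0 ≤ k < n`; suffixes of a uniform string are uniform, so the mean of
`freeSuffixes` is the sum over `1 ≤ k ≤ n`. They differ by `q 0 = 1` and `q n`. -/
lemma sum_freeSuffixes_eq (M n : ℕ) : ∑ x ∈ strings n, freeSuffixes M x + 2 ^ n =
    ∑ x ∈ strings n, firstHit M 0 x + ∑ x ∈ strings n, (1 - hits M 0 x) := by
  induction n with
  | zero =>
    simp only [sum_strings_zero, firstHit, hits, freeSuffixes]
    simp
  | succ n ih =>
    have hc : ∀ b x, freeSuffixes M (b :: x) = (1 - hits M 0 (b :: x)) + freeSuffixes M x := by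
      intro b x
      rw [freeSuffixes]
      split_ifs <;> omega
    have h : ∑ x ∈ strings (n + 1), freeSuffixes M x =
        ∑ x ∈ strings (n + 1), (1 - hits M 0 x) + 2 * ∑ x ∈ strings n, freeSuffixes M x := by
      rw [sum_strings_succ, sum_strings_succ n fun x => 1 - hits M 0 x]
      simp only [hc, Finset.sum_add_distrib]
      ring
    have e : 2 ^ (n + 1) = 2 * 2 ^ n := by ring
    rw [sum_firstHit_succ_eq, h]
    omega

lemma sum_freeSuffixes_le {M : ℕ} (hM : 1 ≤ M) (n : ℕ) :
    ∑ x ∈ strings n, freeSuffixes M x ≤ 2 ^ n * 2 ^ (M + 1) := by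
  have h1 := sum_freeSuffixes_eq M n
  have h2 := sum_firstHit_add_le hM n 0 (by omega)
  have h3 : ∑ x ∈ strings n, (1 - hits M 0 x) ≤ ∑ x ∈ strings n, 1 :=
    Finset.sum_le_sum fun x _ => Nat.sub_le _ _
  rw [Finset.sum_const, card_strings, smul_eq_mul, mul_one] at h3
  omega

/-! ### Independent draws -/

section iid

variable {α β : Type*}

lemma ext_of_expect {p q : PMF α} (h : ∀ f, expect p f = expect q f) : p = q := by
  classical
  ext x
  rw [← expect_indicator, ← expect_indicator, h]

lemma bind_congr_support {p : PMF α} {k k' : α → PMF β} (h : ∀ a ∈ p.support, k a = k' a) :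
    p.bind k = p.bind k' := by
  refine ext_of_expect fun f => ?_
  rw [expect_bind, expect_bind]
  exact expect_congr_support fun a ha => by rw [h a ha]

lemma expect_iid_succ (p : PMF α) (n : ℕ) (f : List α → ℝ≥0∞) :
    expect (iid p (n + 1)) f = expect p fun a => expect (iid p n) fun l => f (a :: l) := by
  rw [iid, expect_bind]
  simp only [expect_map]

lemma iid_map (p : PMF α) (g : α → β) (n : ℕ) :
    iid (p.map g) n = (iid p n).map (List.map g) := by
  induction n with
  | zero => simp [iid, PMF.pure_map]
  | succ n ih =>
    refine ext_of_expect fun f => ?_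
    rw [expect_iid_succ, expect_map, expect_map, expect_iid_succ, ih]
    simp only [expect_map, List.map_cons]

lemma mem_support_iid_succ {p : PMF α} {n : ℕ} {l : List α} :
    l ∈ (iid p (n + 1)).support ↔ ∃ a ∈ p.support, ∃ l' ∈ (iid p n).support, a :: l' = l := by
  rw [iid, PMF.mem_support_bind_iff]
  simp only [PMF.mem_support_map_iff]

lemma length_of_mem_support_iid {p : PMF α} {n : ℕ} : ∀ {l : List α},
    l ∈ (iid p n).support → l.length = n := by
  induction n with
  | zero =>
    intro l hl
    simpa [iid] using hl
  | succ n ih =>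
    intro l hl
    obtain ⟨a, -, l', hl', rfl⟩ := mem_support_iid_succ.1 hl
    rw [List.length_cons, ih hl']

lemma mem_support_of_mem_iid {p : PMF α} {n : ℕ} : ∀ {l : List α},
    l ∈ (iid p n).support → ∀ a ∈ l, a ∈ p.support := by
  induction n with
  | zero =>
    intro l hl
    have : l = [] := by simpa [iid] using hl
    simp [this]
  | succ n ih =>
    intro l hl
    obtain ⟨a, ha, l', hl', rfl⟩ := mem_support_iid_succ.1 hl
    intro b hb
    rcases List.mem_cons.1 hb with rfl | hb
    · exact ha
    · exact ih hl' b hb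

lemma replicate_mem_support_iid {p : PMF α} {a : α} (ha : a ∈ p.support) (n : ℕ) :
    List.replicate n a ∈ (iid p n).support := by
  induction n with
  | zero => simp [iid]
  | succ n ih => exact mem_support_iid_succ.2 ⟨a, ha, _, ih, rfl⟩

lemma expect_iid_sum (p : PMF α) (n : ℕ) (f : α → ℝ≥0∞) :
    expect (iid p n) (fun l => (l.map f).sum) = n * expect p f := by
  induction n with
  | zero => simp [iid, expect_pure]
  | succ n ih =>
    rw [expect_iid_succ]
    simp only [List.map_cons, List.sum_cons, expect_add, expect_const, ih]
    push_cast
    ring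

lemma expect_iid_getD (p : PMF α) (d : α) (f : α → ℝ≥0∞) (n : ℕ) : ∀ j < n,
    expect (iid p n) (fun l => f (l.getD j d)) = expect p f := by
  induction n with
  | zero => intro j hj; omega
  | succ n ih =>
    intro j hj
    rw [expect_iid_succ]
    cases j with
    | zero => simp only [List.getD_cons_zero, expect_const]
    | succ j => simp only [List.getD_cons_succ, ih j (by omega), expect_const]

/-- The probability that `n` independent uniform draws from a set of size `A` hit a given
element. -/
noncomputable def hitProb (A n : ℕ) : ℝ := 1 - (1 - 1 / (A : ℝ)) ^ n

lemma hitProb_succ {A : ℕ} (hA : 1 ≤ A) (n : ℕ) :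
    hitProb A (n + 1) = (A : ℝ)⁻¹ * (1 + (A - 1) * hitProb A n) := by
  have : (A : ℝ) ≠ 0 := by positivity
  unfold hitProb
  rw [pow_succ]
  field_simp
  ring

lemma hitProb_nonneg {A : ℕ} (hA : 1 ≤ A) (n : ℕ) : 0 ≤ hitProb A n := by
  have h1 : (1 : ℝ) ≤ A := by exact_mod_cast hA
  have h2 : 1 / (A : ℝ) ≤ 1 := by rw [div_le_one (by positivity)]; exact h1
  have h3 : 0 ≤ 1 / (A : ℝ) := by positivity
  have := pow_le_one₀ (n := n) (by linarith : 0 ≤ 1 - 1 / (A : ℝ)) (by linarith)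
  unfold hitProb
  linarith

/-- The rational bound `n / (n + A)` is preserved by the recursion for `hitProb`. It suffices
because `A * n / (n + A)`, half the harmonic mean, is at least `min A n / 2`. -/
lemma le_hitProb {A : ℕ} (hA : 1 ≤ A) (n : ℕ) : (n : ℝ) ≤ hitProb A n * (n + A) := by
  induction n with
  | zero => simp [hitProb]
  | succ n ih =>
    have h1 : (1 : ℝ) ≤ A := by exact_mod_cast hA
    have hn : (0 : ℝ) ≤ n := by positivity
    have hp : (n : ℝ) / (n + A) ≤ hitProb A n := by rwa [div_le_iff₀ (by linarith)]
    rw [hitProb_succ hA]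
    have h2 : (A : ℝ)⁻¹ * (1 + (A - 1) * ((n : ℝ) / (n + A))) = (n + 1) / (n + A) := by
      field_simp
      ring
    have h3 : (n + 1 : ℝ) / (n + A) ≤ (A : ℝ)⁻¹ * (1 + (A - 1) * hitProb A n) := by
      rw [← h2]
      have : (0 : ℝ) ≤ A - 1 := by linarith
      gcongr
    calc ((n + 1 : ℕ) : ℝ) = (n + 1) / (n + A) * (n + A) := by
          push_cast
          field_simp
      _ ≤ (A : ℝ)⁻¹ * (1 + (A - 1) * hitProb A n) * (n + A) := by gcongr
      _ ≤ _ := by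
          have : 0 ≤ (A : ℝ)⁻¹ * (1 + (A - 1) * hitProb A n) := le_trans (by positivity) h3
          push_cast
          gcongr
          linarith

lemma min_le_mul_hitProb {A : ℕ} (hA : 1 ≤ A) (n : ℕ) :
    min (A : ℝ) n / 2 ≤ A * hitProb A n := by
  have h := le_hitProb hA n
  have h0 := hitProb_nonneg hA n
  have hA' : (1 : ℝ) ≤ A := by exact_mod_cast hA
  have hn : (0 : ℝ) ≤ n := by positivity
  have hpos : (0 : ℝ) < n + A := by linarith
  have h1 : (n : ℝ) / (n + A) ≤ hitProb A n := by rwa [div_le_iff₀ hpos]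
  refine le_trans ?_ (mul_le_mul_of_nonneg_left h1 (by positivity))
  rw [mul_div_assoc', div_le_div_iff₀ (by norm_num) hpos]
  rcases le_total (A : ℝ) n with h | h
  · rw [min_eq_left h]
    nlinarith
  · rw [min_eq_right h]
    nlinarith

lemma expect_iid_mem [DecidableEq α] {s : Finset α} (hs : s.Nonempty) {x : α} (hx : x ∈ s)
    (n : ℕ) : expect (iid (PMF.uniformOfFinset s hs) n) (fun l => if x ∈ l then 1 else 0) =
      ENNReal.ofReal (hitProb s.card n) := by
  have hc : 1 ≤ s.card := hs.card_pos
  induction n with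
  | zero => simp [iid, expect_pure, hitProb]
  | succ n ih =>
    have h : ∀ a, expect (iid (PMF.uniformOfFinset s hs) n)
        (fun l => if x ∈ a :: l then (1 : ℝ≥0∞) else 0) =
          if x = a then 1 else ENNReal.ofReal (hitProb s.card n) := by
      intro a
      by_cases ha : x = a
      · simp [ha, expect_const]
      · simp [ha, ih]
    rw [expect_iid_succ]
    simp only [h]
    rw [expect_uniformOfFinset, ← Finset.add_sum_erase s _ hx, if_pos rfl,
      Finset.sum_congr rfl fun y hy => if_neg (Finset.ne_of_mem_erase hy).symm, Finset.sum_const,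
      Finset.card_erase_of_mem hx, hitProb_succ hc, nsmul_eq_mul,
      ENNReal.ofReal_mul (by positivity), ENNReal.ofReal_inv_of_pos (by positivity),
      ENNReal.ofReal_natCast, ENNReal.ofReal_add zero_le_one, ENNReal.ofReal_one,
      ENNReal.ofReal_mul, ← Nat.cast_one (R := ℝ), ← Nat.cast_sub hc, ENNReal.ofReal_natCast]
    · rw [sub_nonneg]
      exact_mod_cast hc
    · refine mul_nonneg ?_ (hitProb_nonneg hc n)
      rw [sub_nonneg]
      exact_mod_cast hc

lemma expect_iid_sum_toFinset [DecidableEq α] {s : Finset α} (hs : s.Nonempty) (f : α → ℝ≥0∞)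
    (n : ℕ) : expect (iid (PMF.uniformOfFinset s hs) n) (fun l => ∑ x ∈ l.toFinset, f x) =
      ENNReal.ofReal (hitProb s.card n) * ∑ x ∈ s, f x := by
  have h : ∀ l ∈ (iid (PMF.uniformOfFinset s hs) n).support, ∑ x ∈ l.toFinset, f x =
      ∑ x ∈ s, f x * if x ∈ l then 1 else 0 := by
    intro l hl
    have hsub : l.toFinset ⊆ s := by
      intro x hx
      simpa using mem_support_of_mem_iid hl x (List.mem_toFinset.1 hx)
    rw [← Finset.sum_subset hsub fun x _ hx => by simp [show x ∉ l by simpa using hx]]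
    exact Finset.sum_congr rfl fun x hx => by simp [show x ∈ l by simpa using hx]
  rw [expect_congr_support h, expect_sum, Finset.mul_sum]
  refine Finset.sum_congr rfl fun x hx => ?_
  rw [expect_const_mul, expect_iid_mem hs hx, mul_comm]

end iid

/-! ### The law of the source symbols -/

lemma unif_of_nonempty {s : Finset (List Bool)} (h : s.Nonempty) :
    unif s = PMF.uniformOfFinset s h := by
  rw [unif, dif_pos h]

lemma expect_unif {s : Finset (List Bool)} (h : s.Nonempty) (f : List Bool → ℝ≥0∞) :
    expect (unif s) f = (s.card : ℝ≥0∞)⁻¹ * ∑ x ∈ s, f x := by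
  rw [unif_of_nonempty h, expect_uniformOfFinset]

lemma mem_support_unif {s : Finset (List Bool)} (h : s.Nonempty) {x : List Bool} :
    x ∈ (unif s).support ↔ x ∈ s := by
  rw [unif_of_nonempty h, PMF.mem_support_uniformOfFinset_iff]

/-- Drawing a uniform element after a uniform element was removed gives a uniform element. -/
lemma expect_unif_erase {T : Finset (List Bool)} (hT : 2 ≤ T.card) (f : List Bool → ℝ≥0∞) :
    expect (unif T) (fun x => expect (unif (T.erase x)) f) = expect (unif T) f := by
  have hne : T.Nonempty := Finset.card_pos.1 (by omega)
  have h1 : ∀ x ∈ T, expect (unif (T.erase x)) f =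
      ((T.card - 1 : ℕ) : ℝ≥0∞)⁻¹ * ∑ y ∈ T.erase x, f y := by
    intro x hx
    rw [expect_unif, Finset.card_erase_of_mem hx]
    exact Finset.card_pos.1 (by rw [Finset.card_erase_of_mem hx]; omega)
  have h2 : ∑ x ∈ T, ∑ y ∈ T.erase x, f y = ((T.card - 1 : ℕ) : ℝ≥0∞) * ∑ y ∈ T, f y := by
    rw [Finset.sum_comm' (t' := T) (s' := fun y => T.erase y)]
    · rw [Finset.mul_sum]
      refine Finset.sum_congr rfl fun y hy => ?_
      rw [Finset.sum_const, Finset.card_erase_of_mem hy, nsmul_eq_mul]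
    · intro x y
      simp only [Finset.mem_erase]
      tauto
  rw [expect_unif hne, expect_unif hne, Finset.sum_congr rfl h1, ← Finset.mul_sum, h2]
  congr 1
  rw [← mul_assoc, ENNReal.inv_mul_cancel, one_mul]
  · exact_mod_cast (by omega : T.card - 1 ≠ 0)
  · exact ENNReal.natCast_ne_top _

lemma le_card_strings_sdiff (n : ℕ) (X : Finset (List Bool)) :
    2 ^ n ≤ (strings n \ X).card + X.card := by
  have := Finset.le_card_sdiff X (strings n)
  rw [card_strings] at this
  omega

/-- A removed string of another length changes nothing, and one of the same length is averaged out.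
The 2 leaves a string to draw after the removal. -/
lemma expect_unif_sdiff_insert {X : Finset (List Bool)} {m n : ℕ} (hn : X.card + 2 ≤ 2 ^ n)
    (f : List Bool → ℝ≥0∞) :
    expect (unif (strings n \ X)) (fun x => expect (unif (strings m \ insert x X)) f) =
      expect (unif (strings m \ X)) f := by
  have hc := le_card_strings_sdiff n X
  by_cases hmn : m = n
  · subst hmn
    simp only [Finset.sdiff_insert]
    exact expect_unif_erase (by omega) f
  · have hne : (strings n \ X).Nonempty := Finset.card_pos.1 (by omega)
    rw [expect_congr_support (g := fun _ => expect (unif (strings m \ X)) f), expect_const]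
    intro x hx
    rw [mem_support_unif hne, Finset.mem_sdiff, mem_strings] at hx
    rw [Finset.sdiff_insert, Finset.erase_eq_of_notMem]
    simp only [Finset.mem_sdiff, mem_strings]
    omega

lemma expect_list_sum {α ι : Type*} (p : PMF α) (l : List ι) (f : ι → α → ℝ≥0∞) :
    expect p (fun x => (l.map fun i => f i x).sum) = (l.map fun i => expect p (f i)).sum := by
  induction l with
  | nil => simp [expect_const]
  | cons i l ih => simp only [List.map_cons, List.sum_cons, expect_add, ih]

/-- Although the source symbols are drawn without replacement, each of them is uniformly
distributed. -/
lemma expect_symbolsLaw_sum (f : List Bool → ℝ≥0∞) (ns : List ℕ) : ∀ X : Finset (List Bool),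
    (∀ n ∈ ns, X.card + ns.length ≤ 2 ^ n) →
    expect (symbolsLaw X ns) (fun X' => ∑ x ∈ X', f x) =
      ∑ x ∈ X, f x + (ns.map fun n => expect (unif (strings n \ X)) f).sum := by
  induction ns with
  | nil => simp [symbolsLaw, expect_pure]
  | cons n ns ih =>
    intro X hX
    have hn := hX n (by simp)
    have hc := le_card_strings_sdiff n X
    rw [List.length_cons] at hn
    have hne : (strings n \ X).Nonempty := Finset.card_pos.1 (by omega)
    have h : ∀ x ∈ (unif (strings n \ X)).support,
        expect (symbolsLaw (insert x X) ns) (fun X' => ∑ x ∈ X', f x) =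
          (f x + ∑ x ∈ X, f x) +
            (ns.map fun m => expect (unif (strings m \ insert x X)) f).sum := by
      intro x hx
      rw [mem_support_unif hne, Finset.mem_sdiff] at hx
      rw [ih, Finset.sum_insert hx.2]
      intro m hm
      rw [Finset.card_insert_of_notMem hx.2]
      have := hX m (by simp [hm])
      simp only [List.length_cons] at this
      omega
    rw [symbolsLaw, expect_bind, expect_congr_support h]
    simp only [expect_add, expect_const, List.map_cons, List.sum_cons]
    rw [expect_list_sum _ _ fun m x => expect (unif (strings m \ insert x X)) f]
    have h' : ∀ m ∈ ns, expect (unif (strings n \ X))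
        (fun x => expect (unif (strings m \ insert x X)) f) = expect (unif (strings m \ X)) f := by
      intro m hm
      have := List.length_pos_of_mem hm
      exact expect_unif_sdiff_insert (by omega) f
    rw [List.map_congr_left h']
    ring

/-- The ordered version of `symbolsLaw`. -/
noncomputable def symbolsList : Finset (List Bool) → List ℕ → PMF (List (List Bool))
  | _, [] => PMF.pure []
  | X, n :: ns => (unif (strings n \ X)).bind fun x => (symbolsList (insert x X) ns).map (x :: ·)

lemma symbolsLaw_eq_map (ns : List ℕ) : ∀ X : Finset (List Bool),
    symbolsLaw X ns = (symbolsList X ns).map fun l => X ∪ l.toFinset := by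
  induction ns with
  | nil => simp [symbolsLaw, symbolsList, PMF.pure_map]
  | cons n ns ih =>
    intro X
    rw [symbolsLaw, symbolsList, PMF.map_bind]
    congr 1
    ext1 x
    rw [ih, PMF.map_comp]
    congr 1
    ext1 l
    simp

lemma of_mem_support_symbolsList (ns : List ℕ) : ∀ {X : Finset (List Bool)} {l : List (List Bool)},
    (∀ n ∈ ns, X.card + ns.length ≤ 2 ^ n) → l ∈ (symbolsList X ns).support →
    l.map List.length = ns ∧ l.Nodup ∧ ∀ x ∈ l, x ∉ X := by
  induction ns with
  | nil =>
    intro X l _ hl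
    have : l = [] := by simpa [symbolsList] using hl
    simp [this]
  | cons n ns ih =>
    intro X l hX hl
    have hn := hX n (by simp)
    have hc := le_card_strings_sdiff n X
    rw [List.length_cons] at hn
    have hne : (strings n \ X).Nonempty := Finset.card_pos.1 (by omega)
    rw [symbolsList, PMF.mem_support_bind_iff] at hl
    obtain ⟨x, hx, hl⟩ := hl
    obtain ⟨l', hl', rfl⟩ := (PMF.mem_support_map_iff _ _ _).1 hl
    rw [mem_support_unif hne, Finset.mem_sdiff, mem_strings] at hx
    obtain ⟨h1, h2, h3⟩ := ih (X := insert x X) (fun m hm => by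
      rw [Finset.card_insert_of_notMem hx.2]
      have := hX m (by simp [hm])
      simp only [List.length_cons] at this
      omega) hl'
    refine ⟨by simp [h1, hx.1], List.nodup_cons.2 ⟨fun h => h3 x h (by simp), h2⟩, ?_⟩
    intro y hy
    rcases List.mem_cons.1 hy with rfl | hy
    · exact hx.2
    · exact fun h => h3 y hy (Finset.mem_insert_of_mem h)

/-- Successive conditioning: each factor is bounded given all earlier draws. As the set of earlier
draws is random, the bound `c j` is required for every set filling at most half of the strings of
that length. -/
lemma expect_symbolsList_prod_le (ns : List ℕ) : ∀ (X : Finset (List Bool))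
    (w : ℕ → List Bool → ℝ≥0∞) (c : ℕ → ℝ≥0∞),
    (∀ n ∈ ns, 2 * (X.card + ns.length) ≤ 2 ^ n) →
    (∀ j < ns.length, ∀ X' : Finset (List Bool), 2 * X'.card ≤ 2 ^ ns.getD j 0 →
      expect (unif (strings (ns.getD j 0) \ X')) (w j) ≤ c j) →
    expect (symbolsList X ns) (fun l => ∏ j ∈ Finset.range ns.length, w j (l.getD j [])) ≤
      ∏ j ∈ Finset.range ns.length, c j := by
  induction ns with
  | nil => simp [symbolsList, expect_pure]
  | cons n ns ih =>
    intro X w c hX hw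
    rw [symbolsList, expect_bind]
    simp only [expect_map, List.length_cons, Finset.prod_range_succ', List.getD_cons_zero,
      List.getD_cons_succ, expect_mul_const]
    refine le_trans (expect_mono_support (g := fun x =>
      (∏ j ∈ Finset.range ns.length, c (j + 1)) * w 0 x) fun x _ => ?_) ?_
    · gcongr
      refine ih (insert x X) (fun j => w (j + 1)) (fun j => c (j + 1)) ?_ ?_
      · intro m hm
        have := hX m (by simp [hm])
        have h2 := Finset.card_insert_le x X
        rw [List.length_cons] at this
        omega
      · intro j hj X' hX'
        simpa using hw (j + 1) (by simpa using hj) X' (by simpa using hX')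
    · rw [expect_const_mul]
      gcongr
      have hn := hX n (by simp)
      simpa using hw 0 (by simp) X (by simp only [List.getD_cons_zero]; omega)

/-! ### The source -/

lemma two_mul_length_le {P : PMF ℕ} {A : ℕ} (hP : ∀ n ∈ P.support, 2 * A ≤ 2 ^ n) {ns : List ℕ}
    (hns : ns ∈ (iid P A).support) : ∀ n ∈ ns, 2 * ns.length ≤ 2 ^ n := by
  intro n hn
  rw [length_of_mem_support_iid hns]
  exact hP n (mem_support_of_mem_iid hns n hn)

lemma of_mem_support_alphabetLaw {P : PMF ℕ} {A : ℕ} (hP : ∀ n ∈ P.support, 2 * A ≤ 2 ^ n)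
    {X : Finset (List Bool)} (hX : X ∈ (alphabetLaw P A).support) :
    X.card = A ∧ ∀ x ∈ X, x.length ∈ P.support := by
  rw [alphabetLaw, PMF.mem_support_bind_iff] at hX
  obtain ⟨ns, hns, hX⟩ := hX
  rw [symbolsLaw_eq_map] at hX
  obtain ⟨l, hl, rfl⟩ := (PMF.mem_support_map_iff _ _ _).1 hX
  obtain ⟨h1, h2, -⟩ := of_mem_support_symbolsList ns
    (fun n hn => by have := two_mul_length_le hP hns n hn; simp; omega) hl
  rw [Finset.empty_union]
  constructor
  · rw [List.toFinset_card_of_nodup h2, ← length_of_mem_support_iid hns, ← h1, List.length_map]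
  · intro x hx
    refine mem_support_of_mem_iid hns _ ?_
    rw [← h1]
    exact List.mem_map_of_mem (List.mem_toFinset.1 hx)

/-- The expectation over a random length and a uniform string of this length. -/
noncomputable def expectBlock (P : PMF ℕ) (f : List Bool → ℝ≥0∞) : ℝ≥0∞ :=
  expect P fun n => expect (unif (strings n)) f

lemma expect_alphabetLaw_sum {P : PMF ℕ} {A : ℕ} (hP : ∀ n ∈ P.support, 2 * A ≤ 2 ^ n)
    (f : List Bool → ℝ≥0∞) :
    expect (alphabetLaw P A) (fun X => ∑ x ∈ X, f x) = A * expectBlock P f := by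
  rw [alphabetLaw, expect_bind, expectBlock, ← expect_iid_sum]
  refine expect_congr_support fun ns hns => ?_
  rw [expect_symbolsLaw_sum]
  · simp
  · intro n hn
    have := two_mul_length_le hP hns n hn
    simp
    omega

/-- The expectation of a function of the source alphabet and the source blocks. -/
noncomputable def expectBlocks (P : PMF ℕ) (A B : ℕ) (F : List (List Bool) → ℝ≥0∞) : ℝ≥0∞ :=
  expect (alphabetLaw P A) fun X => expect (iid (unif X) B) F

lemma rate_sourceLaw (P : PMF ℕ) (A B : ℕ) (φ : List Bool → List Bool) :
    rate (sourceLaw P A B) φ = expectBlocks P A B fun Y => ((φ Y.flatten).length : ℝ≥0∞) := by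
  rw [rate_eq_expect, sourceLaw, expect_bind, expectBlocks]
  simp only [expect_map]

section

variable {P : PMF ℕ} {A : ℕ}

lemma expectBlocks_sum (hA : 1 ≤ A) (hP : ∀ n ∈ P.support, 2 * A ≤ 2 ^ n) (B : ℕ)
    (f : List Bool → ℝ≥0∞) :
    expectBlocks P A B (fun Y => (Y.map f).sum) = B * expectBlock P f := by
  have h : ∀ X ∈ (alphabetLaw P A).support, expect (iid (unif X) B) (fun Y => (Y.map f).sum) =
      B * (A : ℝ≥0∞)⁻¹ * ∑ x ∈ X, f x := by
    intro X hX
    have hc := (of_mem_support_alphabetLaw hP hX).1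
    rw [expect_iid_sum, expect_unif (Finset.card_pos.1 (by omega)), hc, mul_assoc]
  rw [expectBlocks, expect_congr_support h, expect_const_mul, expect_alphabetLaw_sum hP,
    mul_assoc, ← mul_assoc _ (A : ℝ≥0∞), ENNReal.inv_mul_cancel, one_mul]
  · exact_mod_cast (by omega : A ≠ 0)
  · exact ENNReal.natCast_ne_top _

lemma expectBlocks_sum_toFinset (hA : 1 ≤ A) (hP : ∀ n ∈ P.support, 2 * A ≤ 2 ^ n) (B : ℕ)
    (f : List Bool → ℝ≥0∞) :
    expectBlocks P A B (fun Y => ∑ x ∈ Y.toFinset, f x) =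
      ENNReal.ofReal (A * hitProb A B) * expectBlock P f := by
  have h : ∀ X ∈ (alphabetLaw P A).support,
      expect (iid (unif X) B) (fun Y => ∑ x ∈ Y.toFinset, f x) =
        ENNReal.ofReal (hitProb A B) * ∑ x ∈ X, f x := by
    intro X hX
    have hc := (of_mem_support_alphabetLaw hP hX).1
    rw [unif_of_nonempty (Finset.card_pos.1 (by omega)), expect_iid_sum_toFinset, hc]
  rw [expectBlocks, expect_congr_support h, expect_const_mul, expect_alphabetLaw_sum hP,
    mul_comm (A : ℝ), ENNReal.ofReal_mul (hitProb_nonneg hA B), ENNReal.ofReal_natCast, mul_assoc]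

lemma expectBlocks_mono (hA : 1 ≤ A) (hP : ∀ n ∈ P.support, 2 * A ≤ 2 ^ n) {B : ℕ}
    {F G : List (List Bool) → ℝ≥0∞}
    (h : ∀ Y, Y.length = B → (∀ x ∈ Y, x.length ∈ P.support) → F Y ≤ G Y) :
    expectBlocks P A B F ≤ expectBlocks P A B G := by
  refine expect_mono_support fun X hX => expect_mono_support fun Y hY => ?_
  obtain ⟨hc, hl⟩ := of_mem_support_alphabetLaw hP hX
  refine h Y (length_of_mem_support_iid hY) fun x hx => hl x ?_
  exact (mem_support_unif (Finset.card_pos.1 (by omega))).1 (mem_support_of_mem_iid hY x hx)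

lemma ne_nil_of_mem_support_sourceLaw (hA : 2 ≤ A) (hP : ∀ n ∈ P.support, 2 * A ≤ 2 ^ n) {B : ℕ}
    (hB : 1 ≤ B) {s : List Bool} (hs : s ∈ (sourceLaw P A B).support) : s ≠ [] := by
  rw [sourceLaw, PMF.mem_support_bind_iff] at hs
  obtain ⟨X, hX, hs⟩ := hs
  obtain ⟨Y, hY, rfl⟩ := (PMF.mem_support_map_iff _ _ _).1 hs
  obtain ⟨hc, hl⟩ := of_mem_support_alphabetLaw hP hX
  obtain ⟨x, hx⟩ := List.exists_mem_of_length_pos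
    (show 0 < Y.length by rw [length_of_mem_support_iid hY]; omega)
  have hxX := (mem_support_unif (Finset.card_pos.1 (by omega))).1 (mem_support_of_mem_iid hY x hx)
  intro h0
  have hx0 := List.flatten_eq_nil_iff.1 h0 x hx
  have := hP _ (hl x hxX)
  rw [hx0] at this
  simp at this
  omega

lemma flatten_replicate_injective {B : ℕ} (hB : 1 ≤ B) {x y : List Bool}
    (h : (List.replicate B x).flatten = (List.replicate B y).flatten) : x = y := by
  have hl := congrArg List.length h
  simp only [List.length_flatten, List.map_replicate, List.sum_replicate, smul_eq_mul] at hl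
  have hl' := Nat.eq_of_mul_eq_mul_left (by omega) hl
  obtain ⟨b, rfl⟩ := Nat.exists_eq_succ_of_ne_zero (by omega : B ≠ 0)
  simp only [List.replicate_succ, List.flatten_cons] at h
  exact (List.append_inj h hl').1

lemma one_le_optimalRate_sourceLaw (hA : 2 ≤ A) (hP : ∀ n ∈ P.support, 2 * A ≤ 2 ^ n) {B : ℕ}
    (hB : 1 ≤ B) : 1 ≤ optimalRate (sourceLaw P A B) := by
  obtain ⟨X, hX⟩ := (alphabetLaw P A).support_nonempty
  obtain ⟨hc, -⟩ := of_mem_support_alphabetLaw hP hX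
  obtain ⟨x, hx, y, hy, hxy⟩ := Finset.one_lt_card.1 (by omega : 1 < X.card)
  have hmem : ∀ z ∈ X, (List.replicate B z).flatten ∈ (sourceLaw P A B).support := by
    intro z hz
    rw [sourceLaw, PMF.mem_support_bind_iff]
    refine ⟨X, hX, (PMF.mem_support_map_iff _ _ _).2 ⟨_, replicate_mem_support_iid ?_ B, rfl⟩⟩
    exact (mem_support_unif ⟨z, hz⟩).2 hz
  exact one_le_optimalRate (hmem x hx) (hmem y hy) fun h => hxy (flatten_replicate_injective hB h)

lemma optimalRate_le_rateVL {γ : ℕ → List Bool} (hγ : IsUniversalIntegerCode γ) (hA : 2 ≤ A)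
    (hP : ∀ n ∈ P.support, 2 * A ≤ 2 ^ n) {B : ℕ} (hB : 1 ≤ B) (M : ℕ) :
    optimalRate (sourceLaw P A B) ≤ rateVL γ P A B M :=
  optimalRate_le ((prefixFreeOn_encodeVL hγ.1 M).mono
    fun _ hs => ne_nil_of_mem_support_sourceLaw hA hP hB hs)

/-! ### Lower bounds on the optimal rate -/

/-- Given the alphabet, the source sequence has few parsings. -/
lemma iid_flatten_apply_le {X : Finset (List Bool)} (hX : X.Nonempty) {K : ℕ}
    (hK : ∀ x ∈ X, 1 ≤ x.length ∧ x.length ≤ K) (n : ℕ) : ∀ s : List Bool,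
    expect (iid (unif X) n) (fun Y => if Y.flatten = s then 1 else 0) ≤
      ((X.card : ℝ≥0∞)⁻¹ * K) ^ n := by
  induction n with
  | zero =>
    intro s
    simp only [iid, expect_pure, pow_zero]
    split_ifs <;> simp
  | succ n ih =>
    intro s
    rw [expect_iid_succ, expect_unif hX]
    have h : ∀ x ∈ X, expect (iid (unif X) n)
        (fun Y => if (x :: Y).flatten = s then (1 : ℝ≥0∞) else 0) ≤
          if x <+: s then ((X.card : ℝ≥0∞)⁻¹ * K) ^ n else 0 := by
      intro x _
      split_ifs with hx
      · obtain ⟨t, rfl⟩ := hx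
        simpa using ih t
      · have h0 : ∀ Y : List (List Bool), (x :: Y).flatten ≠ s :=
          fun Y h => hx ⟨Y.flatten, by simpa using h⟩
        simp only [h0, if_false, expect_const, le_refl]
    -- The first block is a prefix of `s`, and `s` has one prefix of each length.
    have hcard : (X.filter (· <+: s)).card ≤ K := by
      calc (X.filter (· <+: s)).card ≤ (Finset.Icc 1 K).card := by
            refine Finset.card_le_card_of_injOn List.length ?_ ?_
            · intro x hx
              have hx' := (Finset.mem_filter.1 hx).1
              simpa using hK x hx'
            · intro x hx y hy hxy
              have h1 := (Finset.mem_filter.1 hx).2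
              have h2 := (Finset.mem_filter.1 hy).2
              exact (List.prefix_of_prefix_length_le h1 h2 hxy.le).eq_of_length hxy
        _ = K := by simp
    calc (X.card : ℝ≥0∞)⁻¹ * ∑ x ∈ X, expect (iid (unif X) n)
            (fun Y => if (x :: Y).flatten = s then (1 : ℝ≥0∞) else 0)
        ≤ (X.card : ℝ≥0∞)⁻¹ * (K * ((X.card : ℝ≥0∞)⁻¹ * K) ^ n) := by
          gcongr
          refine (Finset.sum_le_sum h).trans ?_
          rw [← Finset.sum_filter, Finset.sum_const, nsmul_eq_mul]
          gcongr
      _ = _ := by ring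

/-- The alphabet is the side information. Each of the `B` blocks contributes a factor `1 / A` for
its probability and at most `l` for the choice of its length. -/
lemma le_optimalRate_of_alphabet (hA : 1 ≤ A) (hP : ∀ n ∈ P.support, 2 * A ≤ 2 ^ n) {l : ℝ}
    (hl : ∀ n ∈ P.support, 1 ≤ n ∧ (n : ℝ) ≤ l) (B : ℕ) :
    ENNReal.ofReal (B * (Real.logb 2 A - Real.logb 2 l)) ≤ optimalRate (sourceLaw P A B) := by
  obtain ⟨n₀, hn₀⟩ := P.support_nonempty
  have hl0 : 0 < l := by
    have h := hl n₀ hn₀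
    have : (1 : ℝ) ≤ n₀ := by exact_mod_cast h.1
    linarith [h.2]
  have h := expect_le_optimalRate_bind (alphabetLaw P A)
    (fun X => (iid (unif X) B).map List.flatten)
    (fun _ => B * (Real.logb 2 A - Real.logb 2 l)) ?_
  · rwa [expect_const] at h
  · intro X hX s
    obtain ⟨hc, hlen⟩ := of_mem_support_alphabetLaw hP hX
    have hA0 : (0 : ℝ) < A := by exact_mod_cast hA
    rw [apply_map_eq_expect]
    refine (iid_flatten_apply_le (K := ⌊l⌋₊) (Finset.card_pos.1 (by omega)) (fun x hx =>
      ⟨(hl _ (hlen x hx)).1, Nat.le_floor (hl _ (hlen x hx)).2⟩) B s).trans ?_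
    have e : (2 : ℝ) ^ (-(B * (Real.logb 2 A - Real.logb 2 l))) = ((A : ℝ)⁻¹ * l) ^ B := by
      rw [← Real.logb_div hA0.ne' hl0.ne', mul_comm, ← neg_mul, Real.rpow_mul (by norm_num),
        Real.rpow_natCast, Real.rpow_neg (by norm_num),
        Real.rpow_logb (by norm_num) (by norm_num) (by positivity), inv_div, div_eq_inv_mul]
    rw [e, ENNReal.ofReal_pow (by positivity), ENNReal.ofReal_mul (by positivity),
      ENNReal.ofReal_inv_of_pos hA0, ENNReal.ofReal_natCast, hc]
    gcongr
    rw [← ENNReal.ofReal_natCast]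
    exact ENNReal.ofReal_le_ofReal (Nat.floor_le hl0.le)

lemma unif_toFinset_eq_map {l : List (List Bool)} (hl : l.Nodup)
    (hr : (Finset.range l.length).Nonempty) : unif l.toFinset =
      (PMF.uniformOfFinset (Finset.range l.length) hr).map fun j => l.getD j [] := by
  have himg : l.toFinset = (Finset.range l.length).image fun j => l.getD j [] := by
    ext x
    simp only [List.mem_toFinset, Finset.mem_image, Finset.mem_range]
    constructor
    · intro hx
      obtain ⟨j, hj, rfl⟩ := List.getElem_of_mem hx
      exact ⟨j, hj, by simp [hj]⟩
    · rintro ⟨j, hj, rfl⟩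
      simp [hj]
  have hinj : Set.InjOn (fun j => l.getD j []) (Finset.range l.length) := by
    intro i hi j hj hij
    have hi' : i < l.length := by simpa using hi
    have hj' : j < l.length := by simpa using hj
    simp only [List.getD_eq_getElem _ _ hi', List.getD_eq_getElem _ _ hj'] at hij
    exact (hl.getElem_inj_iff).1 hij
  have hne : l.toFinset.Nonempty := by
    rw [himg]
    exact hr.image _
  refine ext_of_expect fun f => ?_
  rw [expect_unif hne, expect_map, expect_uniformOfFinset, List.toFinset_card_of_nodup hl,
    Finset.card_range, himg, Finset.sum_image hinj]

/-- The source sequence with the indices of the blocks drawn before the source symbols. -/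
lemma sourceLaw_eq_bind (hP : ∀ n ∈ P.support, 2 * A ≤ 2 ^ n)
    (hr : (Finset.range A).Nonempty) (B : ℕ) :
    sourceLaw P A B = ((iid P A).bind fun ns =>
      (iid (PMF.uniformOfFinset (Finset.range A) hr) B).map fun J => (ns, J)).bind
        fun v => (symbolsList ∅ v.1).map fun l => (v.2.map fun j => l.getD j []).flatten := by
  rw [sourceLaw, alphabetLaw, PMF.bind_bind, PMF.bind_bind]
  refine bind_congr_support fun ns hns => ?_
  refine ext_of_expect fun f => ?_
  rw [symbolsLaw_eq_map]
  simp only [expect_bind, expect_map]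
  rw [expect_comm]
  refine expect_congr_support fun l hl => ?_
  obtain ⟨h1, h2, -⟩ := of_mem_support_symbolsList ns
    (fun n hn => by have := two_mul_length_le hP hns n hn; simp; omega) hl
  have hlA : l.length = A := by
    rw [← length_of_mem_support_iid hns, ← h1, List.length_map]
  subst hlA
  rw [Finset.empty_union, unif_toFinset_eq_map h2 hr, iid_map, expect_map]

/-- At least half of the strings are still available. The lost factor 2 is the origin of the `- 1`
in `E(L) - 1`. -/
lemma expect_unif_indicator_le {n : ℕ} {X : Finset (List Bool)} (hX : 2 * X.card ≤ 2 ^ n)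
    (y : List Bool) : expect (unif (strings n \ X)) (fun x => if x = y then 1 else 0) ≤
      ENNReal.ofReal ((2 : ℝ) ^ (-((n : ℝ) - 1))) := by
  have hc := le_card_strings_sdiff n X
  have hpos : 0 < 2 ^ n := by positivity
  have hne : (strings n \ X).Nonempty := Finset.card_pos.1 (by omega)
  have h1 : (2 : ℝ) ^ (-((n : ℝ) - 1)) = ((2 : ℝ) ^ n / 2)⁻¹ := by
    rw [Real.rpow_neg (by norm_num), Real.rpow_sub (by norm_num), Real.rpow_natCast, Real.rpow_one]
  have h2 : (2 : ℝ) ^ n / 2 ≤ ((strings n \ X).card : ℝ) := by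
    have h3 : (2 : ℝ) ^ n ≤ (strings n \ X).card + X.card := by exact_mod_cast hc
    have h4 : 2 * (X.card : ℝ) ≤ 2 ^ n := by exact_mod_cast hX
    linarith
  rw [expect_unif hne, h1, ENNReal.ofReal_inv_of_pos (by positivity)]
  calc ((strings n \ X).card : ℝ≥0∞)⁻¹ * ∑ x ∈ strings n \ X, (if x = y then 1 else 0)
      ≤ ((strings n \ X).card : ℝ≥0∞)⁻¹ * 1 := by
        gcongr
        rw [Finset.sum_ite_eq']
        split_ifs <;> simp
    _ ≤ _ := by
        rw [mul_one, ← ENNReal.ofReal_natCast]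
        gcongr

lemma eq_of_flatten_map_eq {l l' : List (List Bool)} (h : l.map List.length = l'.map List.length)
    (J : List ℕ)
    (hJ : (J.map fun j => l.getD j []).flatten = (J.map fun j => l'.getD j []).flatten) :
    ∀ j ∈ J, l.getD j [] = l'.getD j [] := by
  have hlen : ∀ j, (l.getD j []).length = (l'.getD j []).length := by
    intro j
    have h1 := congrArg (fun m : List ℕ => m.getD j ([] : List Bool).length) h
    simpa only [List.getD_map] using h1
  induction J with
  | nil => simp
  | cons i J ih =>
    simp only [List.map_cons, List.flatten_cons] at hJ
    obtain ⟨h1, h2⟩ := List.append_inj hJ (hlen i)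
    intro j hj
    rcases List.mem_cons.1 hj with rfl | hj
    · exact h1
    · exact ih h2 j hj

/-- Given the lengths of the symbols and the indices of the blocks, the source sequence determines
the symbols that occur. -/
lemma symbolsList_map_apply_le {ns : List ℕ} (hns : ∀ n ∈ ns, 2 * ns.length ≤ 2 ^ n) (J : List ℕ)
    (s : List Bool) :
    (symbolsList ∅ ns).map (fun l => (J.map fun j => l.getD j []).flatten) s ≤
      ENNReal.ofReal ((2 : ℝ) ^
        (-(∑ j ∈ Finset.range ns.length, if j ∈ J then (ns.getD j 0 : ℝ) - 1 else 0))) := by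
  have hsupp : ∀ l ∈ (symbolsList ∅ ns).support, l.map List.length = ns := fun l hl =>
    (of_mem_support_symbolsList ns
      (fun n hn => by have := hns n hn; simp; omega) hl).1
  rw [apply_map_eq_expect]
  by_cases hex : ∃ l₀ ∈ (symbolsList ∅ ns).support, (J.map fun j => l₀.getD j []).flatten = s
  · obtain ⟨l₀, hl₀, rfl⟩ := hex
    -- The event forces every symbol whose index is in `J` to agree with `l₀`, so its indicator is
    -- below a product of weights, one per symbol; symbols that do not occur get weight 1.
    set w : ℕ → List Bool → ℝ≥0∞ := fun j y =>
      if j ∈ J then (if y = l₀.getD j [] then 1 else 0) else 1 with hw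
    have h1 : ∀ l ∈ (symbolsList ∅ ns).support,
        (if (J.map fun j => l.getD j []).flatten = (J.map fun j => l₀.getD j []).flatten
          then (1 : ℝ≥0∞) else 0) ≤ ∏ j ∈ Finset.range ns.length, w j (l.getD j []) := by
      intro l hl
      split_ifs with he
      · have := eq_of_flatten_map_eq ((hsupp l hl).trans (hsupp l₀ hl₀).symm) J he
        refine le_of_eq (Finset.prod_eq_one fun j _ => ?_).symm
        simp only [hw]
        split_ifs with h1 h2
        · rfl
        · exact absurd (this j h1) h2
        · rfl
      · exact zero_le
    refine (expect_mono_support h1).trans ?_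
    rw [← Finset.sum_neg_distrib, Real.rpow_sum_of_pos (by norm_num),
      ENNReal.ofReal_prod_of_nonneg fun _ _ => by positivity]
    refine expect_symbolsList_prod_le ns ∅ w _ (by simpa using hns) fun j hj X' hX' => ?_
    simp only [hw]
    split_ifs with hjJ
    · exact expect_unif_indicator_le hX' _
    · simp [expect_const]
  · rw [expect_congr_support (g := fun _ => 0) fun l hl => if_neg fun h => hex ⟨l, hl, h⟩,
      expect_const]
    exact zero_le

/-- With lengths and indices as side information the exponent is the sum of `L_j - 1` over the
occurring indices `j`. Indices are independent of lengths, so its mean factorizes. -/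
lemma mul_expect_le_optimalRate (hA : 1 ≤ A) (hP : ∀ n ∈ P.support, 2 * A ≤ 2 ^ n) (B : ℕ) :
    ENNReal.ofReal (A * hitProb A B) * expect P (fun n => ENNReal.ofReal ((n : ℝ) - 1)) ≤
      optimalRate (sourceLaw P A B) := by
  have hr : (Finset.range A).Nonempty := by simpa using (by omega : A ≠ 0)
  rw [sourceLaw_eq_bind hP hr]
  set Q := (iid P A).bind fun ns =>
      (iid (PMF.uniformOfFinset (Finset.range A) hr) B).map fun J => (ns, J) with hQ
  have hQs : ∀ v ∈ Q.support, v.1 ∈ (iid P A).support := by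
    intro v hv
    rw [hQ, PMF.mem_support_bind_iff] at hv
    obtain ⟨ns, hns, hv⟩ := hv
    obtain ⟨J, -, rfl⟩ := (PMF.mem_support_map_iff _ _ _).1 hv
    exact hns
  -- Nonnegative summands are needed to move `ENNReal.ofReal` inside the sum.
  have hP1 : ∀ n ∈ P.support, 1 ≤ n := by
    intro n hn
    have := hP n hn
    by_contra h0
    have h0' : n = 0 := by omega
    subst h0'
    simp at this
    omega
  refine le_trans ?_ (expect_le_optimalRate_bind Q _ (fun v => ∑ j ∈ Finset.range v.1.length,
    if j ∈ v.2 then (v.1.getD j 0 : ℝ) - 1 else 0) fun v hv s =>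
      symbolsList_map_apply_le (two_mul_length_le hP (hQs v hv)) v.2 s)
  have h : ∀ v ∈ Q.support, ENNReal.ofReal (∑ j ∈ Finset.range v.1.length,
      if j ∈ v.2 then (v.1.getD j 0 : ℝ) - 1 else 0) =
        ∑ j ∈ Finset.range A, ENNReal.ofReal ((v.1.getD j 0 : ℝ) - 1) *
          if j ∈ v.2 then 1 else 0 := by
    intro v hv
    have hlen := length_of_mem_support_iid (hQs v hv)
    rw [hlen, ENNReal.ofReal_sum_of_nonneg]
    · refine Finset.sum_congr rfl fun j _ => ?_
      split_ifs <;> simp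
    · intro j hj
      split_ifs
      · have hj' : j < v.1.length := by rw [hlen]; simpa using hj
        have h1 : 1 ≤ v.1.getD j 0 := by
          rw [List.getD_eq_getElem _ _ hj']
          exact hP1 _ (mem_support_of_mem_iid (hQs v hv) _ (List.getElem_mem hj'))
        rw [sub_nonneg]
        exact_mod_cast h1
      · exact le_rfl
  rw [expect_congr_support h, expect_sum]
  have h' : ∀ j ∈ Finset.range A, expect Q (fun v => ENNReal.ofReal ((v.1.getD j 0 : ℝ) - 1) *
      if j ∈ v.2 then 1 else 0) =
        expect P (fun n => ENNReal.ofReal ((n : ℝ) - 1)) * ENNReal.ofReal (hitProb A B) := by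
    intro j hj
    rw [hQ, expect_bind]
    simp only [expect_map, expect_const_mul, expect_iid_mem hr hj, Finset.card_range]
    rw [expect_mul_const,
      expect_iid_getD P 0 (fun n => ENNReal.ofReal ((n : ℝ) - 1)) A j (by simpa using hj)]
  rw [Finset.sum_congr rfl h', Finset.sum_const, Finset.card_range, nsmul_eq_mul,
    ENNReal.ofReal_mul (by positivity), ENNReal.ofReal_natCast]
  exact le_of_eq (by ring)

end

/-! ### Upper bounds on the rate of variable-length deduplication -/

lemma strings_nonempty (n : ℕ) : (strings n).Nonempty :=
  Finset.card_pos.1 (by rw [card_strings]; positivity)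

lemma mul_expect_strings_le {n a b : ℕ} {f : List Bool → ℕ}
    (h : a * ∑ x ∈ strings n, f x ≤ 2 ^ n * b) :
    (a : ℝ≥0∞) * expect (unif (strings n)) (fun x => (f x : ℝ≥0∞)) ≤ b := by
  rw [expect_unif (strings_nonempty n), card_strings]
  have h0 : ((2 ^ n : ℕ) : ℝ≥0∞) ≠ 0 := by positivity
  have h' : (a : ℝ≥0∞) * ∑ x ∈ strings n, (f x : ℝ≥0∞) ≤ ((2 ^ n : ℕ) : ℝ≥0∞) * b := by
    exact_mod_cast h
  calc (a : ℝ≥0∞) * (((2 ^ n : ℕ) : ℝ≥0∞)⁻¹ * ∑ x ∈ strings n, (f x : ℝ≥0∞))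
      = ((2 ^ n : ℕ) : ℝ≥0∞)⁻¹ * (a * ∑ x ∈ strings n, (f x : ℝ≥0∞)) := by ring
    _ ≤ ((2 ^ n : ℕ) : ℝ≥0∞)⁻¹ * (((2 ^ n : ℕ) : ℝ≥0∞) * b) := by gcongr
    _ = b := by
      rw [← mul_assoc, ENNReal.inv_mul_cancel h0 (ENNReal.natCast_ne_top _), one_mul]

lemma expectBlock_length (P : PMF ℕ) :
    expectBlock P (fun x => (x.length : ℝ≥0∞)) = expect P fun n => (n : ℝ≥0∞) := by
  unfold expectBlock
  congr 1
  ext1 n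
  rw [expect_congr_support (g := fun _ => (n : ℝ≥0∞)) fun x hx => ?_, expect_const]
  rw [mem_strings.1 ((mem_support_unif (strings_nonempty n)).1 hx)]

lemma mul_expectBlock_hits_le (P : PMF ℕ) {M : ℕ} (hM : 1 ≤ M) :
    ((2 ^ M : ℕ) : ℝ≥0∞) * expectBlock P (fun x => (hits M 0 x : ℝ≥0∞)) ≤
      expect P fun n => (n : ℝ≥0∞) := by
  rw [expectBlock, ← expect_const_mul]
  exact expect_mono_support fun n _ => mul_expect_strings_le (sum_hits_le hM n)

lemma expectBlock_unsynchronized_le (P : PMF ℕ) {M : ℕ} (hM : 1 ≤ M) :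
    expectBlock P (fun x => ((syncTime M x + freeSuffixes M x : ℕ) : ℝ≥0∞)) ≤
      ((2 ^ (M + 2) : ℕ) : ℝ≥0∞) := by
  rw [← expect_const P ((2 ^ (M + 2) : ℕ) : ℝ≥0∞), expectBlock]
  refine expect_mono_support fun n _ => ?_
  have h : 1 * ∑ x ∈ strings n, (syncTime M x + freeSuffixes M x) ≤ 2 ^ n * 2 ^ (M + 2) := by
    have h1 := sum_syncTime_le hM n
    have h2 := sum_freeSuffixes_le hM n
    have e : 2 ^ n * 2 ^ (M + 2) = 2 * (2 ^ n * 2 ^ (M + 1)) := by ring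
    rw [Finset.sum_add_distrib]
    omega
  simpa using mul_expect_strings_le h

/-- Bounded lengths make the expectation finite, so the real series defining `mean` loses nothing.
-/
lemma expect_natCast_eq {P : PMF ℕ} {l : ℝ} (hl : ∀ n ∈ P.support, (n : ℝ) ≤ l) :
    expect P (fun n => (n : ℝ≥0∞)) = ENNReal.ofReal (mean P) := by
  have hfin : expect P (fun n => (n : ℝ≥0∞)) ≠ ∞ := by
    refine ne_top_of_le_ne_top (ENNReal.ofReal_ne_top (r := l)) ?_
    rw [← expect_const P (ENNReal.ofReal l)]
    refine expect_mono_support fun n hn => ?_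
    rw [← ENNReal.ofReal_natCast]
    exact ENNReal.ofReal_le_ofReal (hl n hn)
  rw [← ENNReal.ofReal_toReal hfin, expect, ENNReal.tsum_toReal_eq]
  · simp [mean]
  · exact fun n => ENNReal.mul_ne_top (P.apply_ne_top n) (ENNReal.natCast_ne_top n)

lemma expect_sub_one_eq {P : PMF ℕ} {l : ℝ} (hl : ∀ n ∈ P.support, 1 ≤ n ∧ (n : ℝ) ≤ l) :
    expect P (fun n => ENNReal.ofReal ((n : ℝ) - 1)) = ENNReal.ofReal (mean P - 1) := by
  have h : expect P (fun n => ENNReal.ofReal ((n : ℝ) - 1)) + 1 = ENNReal.ofReal (mean P) := by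
    rw [← expect_natCast_eq fun n hn => (hl n hn).2, ← expect_const P 1, ← expect_add]
    refine expect_congr_support fun n hn => ?_
    have h1 : (1 : ℝ) ≤ n := by exact_mod_cast (hl n hn).1
    rw [← ENNReal.ofReal_one, ← ENNReal.ofReal_add (by linarith) zero_le_one, sub_add_cancel,
      ENNReal.ofReal_natCast]
  rw [ENNReal.ofReal_sub _ zero_le_one, ← h, ENNReal.ofReal_one, ENNReal.add_sub_cancel_right]
  exact ENNReal.one_ne_top

lemma one_add_clog_le {n : ℕ} (hn : 1 ≤ n) {t : ℝ} (ht : (n : ℝ) ≤ t) :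
    ((1 + Nat.clog 2 (n + 1) : ℕ) : ℝ) ≤ 3 + Real.logb 2 t := by
  have hn' : (1 : ℝ) ≤ n := by exact_mod_cast hn
  have h1 : Nat.clog 2 (n + 1) ≤ Nat.log 2 n + 1 := by
    rw [Nat.clog_le_iff_le_pow (by norm_num)]
    exact Nat.lt_pow_succ_log_self (by norm_num) n
  have h2 : (Nat.log 2 n : ℝ) ≤ Real.logb 2 n := Real.natLog_le_logb n 2
  have h3 : Real.logb 2 n ≤ Real.logb 2 t := Real.logb_le_logb_of_le (by norm_num) (by linarith) ht
  have h4 : (Nat.clog 2 (n + 1) : ℝ) ≤ Nat.log 2 n + 1 := by exact_mod_cast h1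
  push_cast
  linarith

lemma length_flatten_le {Y : List (List Bool)} {l : ℝ} (h : ∀ x ∈ Y, (x.length : ℝ) ≤ l) :
    (Y.flatten.length : ℝ) ≤ l * Y.length := by
  induction Y with
  | nil => simp
  | cons x Y ih =>
    have h1 := h x (by simp)
    have h2 := ih fun y hy => h y (by simp [hy])
    simp only [List.flatten_cons, List.length_append, List.length_cons]
    push_cast
    linarith

/-- The summands pay for the integer code, the distinct blocks, the unsynchronized parts and the
chunk indices; `l` bounds all block lengths. -/
lemma rateVL_le {γ : ℕ → List Bool} (hγ : IsUniversalIntegerCode γ) {P : PMF ℕ} {A : ℕ}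
    (hA : 1 ≤ A) (hP : ∀ n ∈ P.support, 2 * A ≤ 2 ^ n) {l : ℝ} (hl0 : 1 ≤ l)
    (hl : ∀ n ∈ P.support, 1 ≤ n ∧ (n : ℝ) ≤ l) (hmean : 0 ≤ mean P) {B : ℕ} (hB : 1 ≤ B)
    {M : ℕ} (hM : 1 ≤ M) :
    rateVL γ P A B M ≤ ENNReal.ofReal ((2 * Real.logb 2 (l * B) + 3) +
      (A * hitProb A B * mean P + B * 2 ^ (M + 2)) +
      (1 + B + B * (mean P / 2 ^ M)) * (3 + Real.logb 2 (l * B))) := by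
  have hB' : (1 : ℝ) ≤ B := by exact_mod_cast hB
  have hlB : 1 ≤ l * B := by nlinarith
  have hlog : 0 ≤ Real.logb 2 (l * B) := Real.logb_nonneg (by norm_num) hlB
  have hhit := hitProb_nonneg hA B
  set c := ENNReal.ofReal (2 * Real.logb 2 (l * B) + 3) with hc
  set K := ENNReal.ofReal (3 + Real.logb 2 (l * B)) with hK
  -- Replacing the logarithms by their largest values `c` and `K` makes the bound linear in sums
  -- over blocks, so expectations can be taken termwise.
  have hpoint : ∀ Y : List (List Bool), Y.length = B → (∀ x ∈ Y, x.length ∈ P.support) →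
      ((encodeVL γ M Y.flatten).length : ℝ≥0∞) ≤
        (c + (∑ x ∈ Y.toFinset, (x.length : ℝ≥0∞) +
          (Y.map fun x => ((syncTime M x + freeSuffixes M x : ℕ) : ℝ≥0∞)).sum)) +
        ((1 + B) * K + (Y.map fun x => (hits M 0 x : ℝ≥0∞)).sum * K) := by
    intro Y hY hx
    have hlen : (Y.flatten.length : ℝ) ≤ l * B := by
      rw [← hY]
      exact length_flatten_le fun x h => (hl _ (hx x h)).2
    have hpos : 1 ≤ Y.flatten.length := by
      obtain ⟨x, hxY⟩ := List.exists_mem_of_length_pos (show 0 < Y.length by omega)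
      have h1 := (hl _ (hx x hxY)).1
      have h2 := (List.sublist_flatten_of_mem hxY).length_le
      omega
    have h1 : ((γ Y.flatten.length).length : ℝ≥0∞) ≤ c := by
      rw [← ENNReal.ofReal_natCast]
      refine ENNReal.ofReal_le_ofReal ((hγ.2 _ hpos).trans ?_)
      have : Real.logb 2 (Y.flatten.length : ℝ) ≤ Real.logb 2 (l * B) :=
        Real.logb_le_logb_of_le (by norm_num) (by exact_mod_cast hpos) hlen
      linarith
    have h2 : ((1 + Nat.clog 2 (Y.flatten.length + 1) : ℕ) : ℝ≥0∞) ≤ K := by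
      rw [← ENNReal.ofReal_natCast]
      exact ENNReal.ofReal_le_ofReal (one_add_clog_le hpos hlen)
    have h3 := length_encodeVL_le γ hM Y
    rw [hY] at h3
    have h4 : ((encodeVL γ M Y.flatten).length : ℝ≥0∞) ≤
        ((γ Y.flatten.length).length : ℝ≥0∞) + (∑ x ∈ Y.toFinset, (x.length : ℝ≥0∞) +
          (((Y.map fun x => syncTime M x + freeSuffixes M x).sum : ℕ) : ℝ≥0∞)) +
        (1 + B + (((Y.map (hits M 0)).sum : ℕ) : ℝ≥0∞)) *
          ((1 + Nat.clog 2 (Y.flatten.length + 1) : ℕ) : ℝ≥0∞) := by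
      exact_mod_cast h3
    rw [Nat.cast_list_sum, Nat.cast_list_sum, List.map_map, List.map_map] at h4
    refine h4.trans ?_
    rw [← add_mul]
    gcongr
    · exact le_rfl
    · exact le_rfl
  have hmean' := expect_natCast_eq fun n hn => (hl n hn).2
  have hH : expectBlock P (fun x => (hits M 0 x : ℝ≥0∞)) ≤ ENNReal.ofReal (mean P / 2 ^ M) := by
    have h := mul_expectBlock_hits_le P hM
    rw [hmean'] at h
    rw [ENNReal.ofReal_div_of_pos (by positivity), ENNReal.le_div_iff_mul_le (by simp) (by simp),
      mul_comm]
    convert h using 2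
    rw [← ENNReal.ofReal_natCast]
    push_cast
    rfl
  rw [rateVL, rate_sourceLaw]
  refine (expectBlocks_mono hA hP hpoint).trans ?_
  have hlin : expectBlocks P A B (fun Y => (c + (∑ x ∈ Y.toFinset, (x.length : ℝ≥0∞) +
          (Y.map fun x => ((syncTime M x + freeSuffixes M x : ℕ) : ℝ≥0∞)).sum)) +
        ((1 + B) * K + (Y.map fun x => (hits M 0 x : ℝ≥0∞)).sum * K)) =
      (c + (ENNReal.ofReal (A * hitProb A B) * ENNReal.ofReal (mean P) +
        B * expectBlock P (fun x => ((syncTime M x + freeSuffixes M x : ℕ) : ℝ≥0∞)))) +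
      ((1 + B) * K + B * expectBlock P (fun x => (hits M 0 x : ℝ≥0∞)) * K) := by
    rw [← expectBlocks_sum hA hP, ← expectBlocks_sum hA hP, ← hmean', ← expectBlock_length,
      ← expectBlocks_sum_toFinset hA hP]
    simp only [expectBlocks, expect_add, expect_const, expect_mul_const]
  rw [hlin]
  calc _ ≤ (c + (ENNReal.ofReal (A * hitProb A B) * ENNReal.ofReal (mean P) +
        B * ((2 ^ (M + 2) : ℕ) : ℝ≥0∞))) +
      ((1 + B) * K + B * ENNReal.ofReal (mean P / 2 ^ M) * K) := by
        gcongr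
        exact expectBlock_unsynchronized_le P hM
    _ = _ := by
      have e1 : (B : ℝ≥0∞) = ENNReal.ofReal B := (ENNReal.ofReal_natCast B).symm
      have e2 : ((2 ^ (M + 2) : ℕ) : ℝ≥0∞) = ENNReal.ofReal (2 ^ (M + 2)) := by
        rw [← ENNReal.ofReal_natCast]
        push_cast
        rfl
      have hd : 0 ≤ mean P / 2 ^ M := by positivity
      rw [e1, e2, ← ENNReal.ofReal_one, ← ENNReal.ofReal_add (by positivity) (by positivity), hK,
        ← ENNReal.ofReal_mul (by positivity), ← ENNReal.ofReal_mul (by positivity),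
        ← ENNReal.ofReal_mul (by positivity), ← ENNReal.ofReal_mul (by positivity),
        ← ENNReal.ofReal_mul (by positivity),
        ← ENNReal.ofReal_add (by positivity) (by positivity), hc,
        ← ENNReal.ofReal_add (by positivity) (by positivity),
        ← ENNReal.ofReal_add (by positivity) (by positivity),
        ← ENNReal.ofReal_add (by positivity) (by positivity)]
      congr 1
      ring

/-! ### Comparison of the bounds -/

lemma mul_hitProb_le {A : ℕ} (hA : 1 ≤ A) (n : ℕ) : A * hitProb A n ≤ n := by
  have hA' : (1 : ℝ) ≤ A := by exact_mod_cast hA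
  have h2 : 1 / (A : ℝ) ≤ 1 := by rw [div_le_one (by positivity)]; exact hA'
  have h := one_add_mul_le_pow (a := -(1 / (A : ℝ))) (by linarith) n
  have h1 : hitProb A n ≤ n * (1 / A) := by
    unfold hitProb
    rw [sub_eq_add_neg 1 (1 / (A : ℝ))]
    linarith
  calc A * hitProb A n ≤ A * (n * (1 / A)) := by gcongr
    _ = n := by field_simp

lemma sqrt_le_two_pow_ceil {l : ℝ} (hl : 0 < l) : √l ≤ 2 ^ ⌈Real.logb 2 l / 2⌉₊ := by
  have h : √l = (2 : ℝ) ^ (Real.logb 2 l / 2) := by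
    rw [div_eq_mul_inv, Real.rpow_mul (by norm_num), Real.rpow_logb (by norm_num) (by norm_num) hl,
      Real.sqrt_eq_rpow, one_div]
  rw [h, ← Real.rpow_natCast]
  exact Real.rpow_le_rpow_of_exponent_le (by norm_num) (Nat.le_ceil _)

lemma two_pow_ceil_le {l : ℝ} (hl : 1 ≤ l) : (2 : ℝ) ^ ⌈Real.logb 2 l / 2⌉₊ ≤ 2 * √l := by
  have h : 2 * √l = (2 : ℝ) ^ (Real.logb 2 l / 2 + 1) := by
    rw [Real.rpow_add (by norm_num), Real.rpow_one, div_eq_mul_inv, Real.rpow_mul (by norm_num),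
      Real.rpow_logb (by norm_num) (by norm_num) (by linarith), Real.sqrt_eq_rpow, one_div, mul_comm]
  rw [h, ← Real.rpow_natCast]
  refine Real.rpow_le_rpow_of_exponent_le (by norm_num) (Nat.ceil_lt_add_one ?_).le
  have := Real.logb_nonneg (by norm_num : (1 : ℝ) < 2) hl
  positivity

/-- Here `e * l = e * (l - 1) + e ≤ R + B`, and the leading excess is `Q * L` with `Q = B * (1 +
s)`. The extra `Q * L / 3` absorbs the lower-order terms, mainly `12 * Q`, once `L ≥ 72` and `B ≥
1000`. -/
lemma redundancy_le {l e w B L R s : ℝ} (hB : 1000 ≤ B) (hs : 1 ≤ s) (hsl : s * s = l)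
    (hw1 : s ≤ w) (hw2 : w ≤ 2 * s) (hL : 72 ≤ L) (he : e ≤ B) (hR : e * (l - 1) ≤ R) :
    (2 * (L + 1) + 3) + (e * l + B * (w * 4)) + (1 + B + B * (l / w)) * (3 + (L + 1)) ≤
      R + 4 * B * (1 + s) * L / 3 := by
  have hdiv : l / w ≤ s := by
    rw [div_le_iff₀ (by linarith), ← hsl]
    gcongr
  have h1 : (1 + B + B * (l / w)) * (3 + (L + 1)) ≤ (1 + B + B * s) * (4 + L) := by
    have : 1 + B + B * (l / w) ≤ 1 + B + B * s := by gcongr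
    nlinarith
  have h2 : B * (w * 4) ≤ 8 * (B * s) := by nlinarith
  set Q := B * (1 + s) with hQ
  have hQB : 2 * B ≤ Q := by nlinarith
  have h3 : B * s = Q - B := by rw [hQ]; ring
  have h4 : 0 ≤ (Q - 1000) * (L - 72) := mul_nonneg (by linarith) (by linarith)
  have h5 : 4 * B * (1 + s) * L = 4 * (Q * L) := by rw [hQ]; ring
  rw [h3] at h1 h2
  rw [h5]
  nlinarith

/-- The first summand is at most `2R`. The second is at most `B log a`, which `hR'` bounds by `R + B
log(2l)`; the subtracted `2B log(2l)` more than compensates. -/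
lemma denominator_le {a B l e R : ℝ} (ha : 2 ≤ a) (hB : 0 ≤ B) (hl : 1 ≤ l) (hR0 : 0 ≤ R)
    (he : min a B / 2 ≤ e) (hR : e * (l - 1) ≤ R)
    (hR' : B * (Real.logb 2 a - Real.logb 2 (2 * l)) ≤ R) :
    max (min a B * (l - 1) + max (B - a) 0 * Real.logb 2 (a / 2) - 2 * B * Real.logb 2 (2 * l)) 0 ≤
      3 * R := by
  refine max_le ?_ (by linarith)
  have h1 : 0 ≤ Real.logb 2 (a / 2) := Real.logb_nonneg (by norm_num) (by linarith)
  have h2 : Real.logb 2 (a / 2) ≤ Real.logb 2 a :=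
    Real.logb_le_logb_of_le (by norm_num) (by linarith) (by linarith)
  have h3 : 0 ≤ Real.logb 2 (2 * l) := Real.logb_nonneg (by norm_num) (by linarith)
  have h4 : max (B - a) 0 * Real.logb 2 (a / 2) ≤ B * Real.logb 2 a :=
    mul_le_mul (max_le (by linarith) hB) h2 h1 hB
  have h5 : min a B / 2 * (l - 1) ≤ R :=
    (mul_le_mul_of_nonneg_right he (by linarith)).trans hR
  have h6 : 0 ≤ B * Real.logb 2 (2 * l) := mul_nonneg hB h3
  rw [mul_sub] at hR'
  linarith

lemma div_le_one_add_div {r R : ℝ≥0∞} (hR : R ≠ ∞) {num den : ℝ} (hnum : 0 < num)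
    (hr : r ≤ ENNReal.ofReal (R.toReal + num / 3)) (hden : den ≤ 3 * R.toReal) (hden0 : 0 ≤ den) :
    r / R ≤ 1 + ENNReal.ofReal num / ENNReal.ofReal den := by
  rcases hden0.eq_or_lt with rfl | hpos
  · rw [ENNReal.ofReal_zero, ENNReal.div_zero (by simpa using hnum)]
    simp
  · refine ENNReal.div_le_of_le_mul (hr.trans ?_)
    rw [← ENNReal.ofReal_div_of_pos hpos, ← ENNReal.ofReal_one,
      ← ENNReal.ofReal_add zero_le_one (by positivity)]
    conv_rhs => rw [← ENNReal.ofReal_toReal hR]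
    rw [← ENNReal.ofReal_mul (by positivity)]
    refine ENNReal.ofReal_le_ofReal ?_
    have h : num / 3 ≤ num / den * R.toReal := by
      rw [div_mul_eq_mul_div, div_le_div_iff₀ (by norm_num) hpos]
      nlinarith
    linarith

end Dedup

/-! ### Assembly of the bounds -/

theorem theorem2 :
    ∃ B₀ : ℕ, ∀ (γ : ℕ → List Bool) (P : PMF ℕ) (A B : ℕ),
      Dedup.IsUniversalIntegerCode γ →
      (∀ n ∈ P.support, Dedup.mean P / 2 ≤ n ∧ (n : ℝ) ≤ 2 * Dedup.mean P) →
      2 ≤ A →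
      (A : ℝ) ≤ (2 : ℝ) ^ (Dedup.mean P / 2 - 1) →
      B₀ ≤ B →
      let EL : ℝ := Dedup.mean P
      let Rstar : ℝ≥0∞ := Dedup.optimalRate (Dedup.sourceLaw P A B)
      let num : ℝ := 4 * B * (1 + √EL) * Real.logb 2 (B * EL)
      let den : ℝ :=
        max (min (A : ℝ) B * (EL - 1) + max ((B : ℝ) - A) 0 * Real.logb 2 ((A : ℝ) / 2)
          - 2 * B * Real.logb 2 (2 * EL)) 0
      -- The quotient is taken in `ℝ≥0∞`: it is `∞` if the denominator is `0`.
      let bound : ℝ≥0∞ := 1 + ENNReal.ofReal num / ENNReal.ofReal den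
      0 < Rstar ∧ Rstar < ∞ ∧
      (∀ M : ℕ, 1 ≤ M → 1 ≤ Dedup.rateVL γ P A B M / Rstar) ∧
      1 ≤ Dedup.anchorLength P ∧
      Dedup.rateVL γ P A B (Dedup.anchorLength P) / Rstar ≤ bound ∧
      1 ≤ Dedup.optimizedRateVL γ P A B / Rstar ∧
      Dedup.optimizedRateVL γ P A B / Rstar ≤ bound := by
  -- This makes `log(B * EL)` at least 72, as `redundancy_le` requires.
  refine ⟨2 ^ 72, ?_⟩
  intro γ P A B hγ hsupp hA hAle hB EL Rstar num den bound
  have hA1 : 1 ≤ A := by omega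
  have hB72 : (2 : ℝ) ^ 72 ≤ B := by exact_mod_cast hB
  have hB1 : 1 ≤ B := le_trans (by norm_num) hB
  have hBpos : (0 : ℝ) < B := by exact_mod_cast hB1
  -- From `2 ≤ A ≤ 2^(EL/2 - 1)`.
  have hEL : 4 ≤ EL := by
    by_contra hlt
    have h1 : Dedup.mean P / 2 - 1 < 1 := by
      have : Dedup.mean P < 4 := not_le.1 hlt
      linarith
    have h2 := Real.rpow_lt_rpow_of_exponent_lt (by norm_num : (1 : ℝ) < 2) h1
    rw [Real.rpow_one] at h2
    have h3 : (2 : ℝ) ≤ A := by exact_mod_cast hA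
    linarith
  have hP : ∀ n ∈ P.support, 2 * A ≤ 2 ^ n := by
    intro n hn
    have h1 : (A : ℝ) ≤ 2 ^ ((n : ℝ) - 1) :=
      hAle.trans (Real.rpow_le_rpow_of_exponent_le (by norm_num) (by linarith [(hsupp n hn).1]))
    rw [Real.rpow_sub_one (by norm_num), Real.rpow_natCast] at h1
    have h2 : (2 * A : ℝ) ≤ 2 ^ n := by linarith
    exact_mod_cast h2
  have hlen : ∀ n ∈ P.support, 1 ≤ n ∧ (n : ℝ) ≤ 2 * EL := by
    intro n hn
    refine ⟨?_, (hsupp n hn).2⟩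
    have h1 : (1 : ℝ) ≤ n := by linarith [(hsupp n hn).1]
    exact_mod_cast h1
  have hupper := fun M (hM : 1 ≤ M) => Dedup.rateVL_le hγ hA1 hP (by linarith : 1 ≤ 2 * EL) hlen
    (by linarith : 0 ≤ EL) hB1 hM
  have hRle := Dedup.optimalRate_le_rateVL hγ hA hP hB1
  have hR1 : 1 ≤ Rstar := Dedup.one_le_optimalRate_sourceLaw hA hP hB1
  have hR0 : Rstar ≠ 0 := (zero_lt_one.trans_le hR1).ne'
  have hRtop : Rstar ≠ ∞ :=
    ne_top_of_le_ne_top ENNReal.ofReal_ne_top ((hRle 1).trans (hupper 1 le_rfl))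
  have hone : ∀ r : ℝ≥0∞, Rstar ≤ r → 1 ≤ r / Rstar := fun r hr => by
    rwa [ENNReal.le_div_iff_mul_le (Or.inl hR0) (Or.inl hRtop), one_mul]
  have hsqrt : √EL * √EL = EL := Real.mul_self_sqrt (by linarith)
  have hs1 : 1 ≤ √EL := Real.one_le_sqrt.2 (by linarith)
  have hlog : 72 ≤ Real.logb 2 (B * EL) := by
    -- `EL ≥ 4` only helps here: `B` alone already reaches `2^72`.
    rw [Real.le_logb_iff_rpow_le (by norm_num) (by positivity)]
    have : (2 : ℝ) ^ (72 : ℝ) = 2 ^ 72 := by norm_num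
    rw [this]
    nlinarith
  have hlog' : Real.logb 2 (2 * EL * B) = Real.logb 2 (B * EL) + 1 := by
    rw [show 2 * EL * B = B * EL * 2 by ring, Real.logb_mul (by positivity) (by norm_num),
      Real.logb_self_eq_one (by norm_num)]
  have hhit := Dedup.hitProb_nonneg hA1 B
  have hlow : A * Dedup.hitProb A B * (EL - 1) ≤ Rstar.toReal := by
    rw [← ENNReal.ofReal_le_iff_le_toReal hRtop, ENNReal.ofReal_mul (by positivity),
      ← Dedup.expect_sub_one_eq hlen]
    exact Dedup.mul_expect_le_optimalRate hA1 hP B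
  have hlow' : B * (Real.logb 2 A - Real.logb 2 (2 * EL)) ≤ Rstar.toReal := by
    rw [← ENNReal.ofReal_le_iff_le_toReal hRtop]
    exact Dedup.le_optimalRate_of_alphabet hA1 hP hlen B
  have hanchor : 1 ≤ Dedup.anchorLength P := by
    refine Nat.one_le_ceil_iff.2 ?_
    have := Real.logb_pos (by norm_num : (1 : ℝ) < 2) (by linarith : 1 < EL)
    exact half_pos this
  have hnum : 0 < num := by positivity
  have hrate : Dedup.rateVL γ P A B (Dedup.anchorLength P) ≤
      ENNReal.ofReal (Rstar.toReal + num / 3) := by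
    refine (hupper _ hanchor).trans (ENNReal.ofReal_le_ofReal ?_)
    rw [hlog', pow_add]
    norm_num only
    exact Dedup.redundancy_le (by linarith) hs1 hsqrt
      (Dedup.sqrt_le_two_pow_ceil (by linarith)) (Dedup.two_pow_ceil_le (by linarith)) hlog
      (Dedup.mul_hitProb_le hA1 B) hlow
  have hden : den ≤ 3 * Rstar.toReal :=
    Dedup.denominator_le (by exact_mod_cast hA) hBpos.le (by linarith) ENNReal.toReal_nonneg
      (Dedup.min_le_mul_hitProb hA1 B) hlow hlow'
  have hbound : Dedup.rateVL γ P A B (Dedup.anchorLength P) / Rstar ≤ bound :=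
    Dedup.div_le_one_add_div hRtop hnum hrate hden (le_max_right _ _)
  refine ⟨pos_iff_ne_zero.2 hR0, hRtop.lt_top, fun M _ => hone _ (hRle M), hanchor, hbound,
    hone _ (le_iInf₂ fun M _ => hRle M), le_trans ?_ hbound⟩
  -- The optimized rate is at most the rate at the explicit anchor length, so it inherits the bound.
  gcongr
  exact iInf₂_le (Dedup.anchorLength P) hanchor
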